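/- **Market model.** Let $\mathcal N$ be a set of buses, $\mathcal L\subseteq\mathcal N\times\mathcal N$ a finite set of directed lines, $\mathcal P$ a finite set of market participants, $\mathcal P(n)$ the participants located at bus $n$, and let $(\Xi,\mathbb P)$ be a probability space of scenarios. Put $n_1=|\mathcal P|+|\mathcal L|$. A day-ahead decision is a vector $y_1=((x_i)_{i\in\mathcal P},(f_l)_{l\in\mathcal L})\in\mathbb R^{n_1}$ and a real-time decision is a vector $y_2=((X_i)_{i\in\mathcal P},(F_l)_{l\in\mathcal L})\in\mathbb R^{n_1}$. Given real bids $c_i$, premiums $\delta_i^\pm$, bounds $x_i^{\min},x_i^{\max},X_i^{\min},X_i^{\max}$ $(i\in\mathcal P)$, $f_l^{\min},f_l^{\max},F_l^{\min},F_l^{\max}$ $(l\in\mathcal L)$, measurable random available quantities $X_i^{\mathrm{avail}}:\Xi\to\mathbb R$, and a set $\mathcal F\subseteq\mathbb R^{\mathcal L}$ of physically admissible flows, let $$\mathcal C_1=\{y_1 : x_i^{\min}\le x_i\le x_i^{\max}\ \forall i,\ f_l^{\min}\le f_l\le f_l^{\max}\ \forall l,\ f\in\mathcal F\},$$ $$\mathcal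 C_2(\xi)=\{y_2 : \max\{X_i^{\min},-X_i^{\mathrm{avail}}(\xi)\}\le X_i\le\min\{X_i^{\max},X_i^{\mathrm{avail}}(\xi)\}\ \forall i,\ F_l^{\min}\le F_l\le F_l^{\max}\ \forall l,\ F\in\mathcal F\}.$$ With the net flow $\tau_n(f)=\sum_{(j,n)\in\mathcal L}f_{jn}-\sum_{(n,j)\in\mathcal L}f_{nj}$, let, for $n\in\mathcal N$, $$g_1(y_1)_n=\tau_n(f)+\sum_{j\in\mathcal P(n)}x_j,\qquad g_2(y_1,y_2)_n=\tau_n(F)-\tau_n(f)+\sum_{j\in\mathcal P(n)}(X_j-x_j),$$ and, with $z_+=\max\{z,0\}$ and $z_-=\max\{-z,0\}$, $$f_1(y_1)=\sum_{i\in\mathcal P}c_ix_i,\qquad f_2(y_1,y_2)=\sum_{i\in\mathcal P}\big[(c_i+\delta_i^+)(X_i-x_i)_+-(c_i-\delta_i^-)(X_i-x_i)_-\big].$$ Let $H(y_1,\xi)=\inf\{f_2(y_1,y_2): y_2\in\mathcal C_2(\xi),\ g_2(y_1,y_2)=0\}$ (with $\inf\emptyset=+\infty$), and let $\phi(y_1,\xi)=f_1(y_1)+H(y_1,\xi)$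 if $y_1\in\mathcal C_1$ and $g_1(y_1)=0$, and $\phi(y_1,\xi)=+\infty$ otherwise. **Convexity assumption.** $\mathcal C_1$ and, for $\mathbb P$-almost every $\xi$, $\mathcal C_2(\xi)$ are convex, closed and nonempty, and $f_1$ and $f_2$ are convex on $\mathbb R^{n_1}$ and on $\mathbb R^{n_1}\times\mathbb R^{n_1}$, respectively. **Primal problem.** The mean-vector formulation is $$\text{(P-MV)}\qquad\min_{y_1\in L^\infty(\Xi;\mathbb R^{n_1})}\ \mathbb E[\phi(y_1(\xi),\xi)]\quad\text{subject to}\quad y_1(\xi)-\mathbb E[y_1]=0\ \text{ a.s.}$$ **Proposition.** Suppose that the convexity assumption holds and that (P-MV) has an optimal solution $\bar y_1$ with optimal value $\nu_p^\star<\infty$. Then the dual problem $$\text{(D-MV)}\qquad\sup_{\mu\in L^1(\Xi;\mathbb R^{n_1})}\ \inf_{y_1\in L^\infty(\Xi;\mathbb R^{n_1})}\ \mathbb E\big[\phi(y_1(\xi),\xi)+\langle\mu(\xi)-\mathbb E[\mu],\,y_1(\xi)\rangle\big]$$ is feasible, that is, its objective (the inner infimum) is $>-\infty$ for some $\mu\in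 L^1$, and its optimal value equals $\nu_p^\star$. The same two assertions hold for the dual written in the form $\sup_{\mu\in L^1}\{-\mathbb E[\mathbb L(\mu,\xi)]\}$, where $\mathbb L(\mu,\xi)=\sup_{y\in\mathbb R^{n_1}}\{\langle\mu(\xi)-\mathbb E[\mu],y\rangle-\phi(y,\xi)\}$. -/

import Mathlib

open MeasureTheory
open scoped ENNReal

noncomputable section

/-- Vectors `((x_i)_{i ∈ P}, (f_l)_{l ∈ L})`: one quantity per participant, one flow per line. This
is the space of the day-ahead decisions and also that of the real-time decisions. -/
abbrev Decision {N : Type*} (P : Type*) (L : Finset (N × N)) : Type _ :=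
  EuclideanSpace ℝ (P ⊕ L)

/-- Expectation of an extended-real random variable: expectation of the positive part minus
expectation of the negative part, with the convention `∞ - ∞ = ∞` of convex minimization. -/
def expectE {Ξ : Type*} [MeasurableSpace Ξ] (ℙ : Measure Ξ) (Z : Ξ → EReal) : EReal :=
  open Classical in
  if ∫⁻ ξ, (Z ξ).toENNReal ∂ℙ = ⊤ then ⊤
  else ((∫⁻ ξ, (Z ξ).toENNReal ∂ℙ : ℝ≥0∞) : EReal) - ((∫⁻ ξ, (-Z ξ).toENNReal ∂ℙ : ℝ≥0∞) : EReal)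

/-- Data of a two-settlement electricity market with buses `N`, participants `P`, directed lines
`L ⊆ N × N` and scenario space `Ξ`. -/
structure Market (N P : Type*) (L : Finset (N × N)) (Ξ : Type*) where
  /-- the bus at which a participant is located -/
  node : P → N
  /-- day-ahead price bids -/
  c : P → ℝ
  /-- premium for positive deviations -/
  δp : P → ℝ
  /-- premium for negative deviations -/
  δm : P → ℝ
  /-- day-ahead bounds on cleared amounts -/
  xmin : P → ℝ
  xmax : P → ℝ
  /-- day-ahead bounds on flows -/
  fmin : L → ℝ
  fmax : L → ℝ
  /-- real-time bounds on cleared amounts -/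
  Xmin : P → ℝ
  Xmax : P → ℝ
  /-- real-time bounds on flows -/
  Fmin : L → ℝ
  Fmax : L → ℝ
  /-- observed available quantity of a participant in a scenario -/
  Xavail : P → Ξ → ℝ
  /-- flows compatible with the physics of the network -/
  flowSet : Set (L → ℝ)

namespace Market

variable {N P : Type*} {L : Finset (N × N)} {Ξ : Type*}

/-- Net flow into bus `i`: inflow minus outflow. -/
def netFlow [DecidableEq N] (f : L → ℝ) (i : N) : ℝ :=
  (∑ l : L with l.1.2 = i, f l) - ∑ l : L with l.1.1 = i, f l

/-- The day-ahead constraint set `C₁`. -/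
def C1 (M : Market N P L Ξ) : Set (Decision P L) :=
  {y | (∀ i : P, M.xmin i ≤ y (Sum.inl i) ∧ y (Sum.inl i) ≤ M.xmax i) ∧
    (∀ l : L, M.fmin l ≤ y (Sum.inr l) ∧ y (Sum.inr l) ≤ M.fmax l) ∧
    (fun l : L => y (Sum.inr l)) ∈ M.flowSet}

/-- The real-time constraint set `C₂(ξ)`. -/
def C2 (M : Market N P L Ξ) (ξ : Ξ) : Set (Decision P L) :=
  {z | (∀ i : P, max (M.Xmin i) (-M.Xavail i ξ) ≤ z (Sum.inl i) ∧
      z (Sum.inl i) ≤ min (M.Xmax i) (M.Xavail i ξ)) ∧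
    (∀ l : L, M.Fmin l ≤ z (Sum.inr l) ∧ z (Sum.inr l) ≤ M.Fmax l) ∧
    (fun l : L => z (Sum.inr l)) ∈ M.flowSet}

/-- Residual of the day-ahead flow balance. -/
def g1 [DecidableEq N] [Fintype P] (M : Market N P L Ξ) (y : Decision P L) (i : N) : ℝ :=
  netFlow (fun l : L => y (Sum.inr l)) i + ∑ j : P with M.node j = i, y (Sum.inl j)

/-- Residual of the real-time flow balance. -/
def g2 [DecidableEq N] [Fintype P] (M : Market N P L Ξ) (y z : Decision P L) (i : N) : ℝ :=
  netFlow (fun l : L => z (Sum.inr l)) i - netFlow (fun l : L => y (Sum.inr l)) i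
    + ∑ j : P with M.node j = i, (z (Sum.inl j) - y (Sum.inl j))

/-- First-stage cost. -/
def f1 [Fintype P] (M : Market N P L Ξ) (y : Decision P L) : ℝ :=
  ∑ i : P, M.c i * y (Sum.inl i)

/-- Second-stage cost of adjusting the day-ahead decision `y` to the real-time decision `z`. -/
def f2 [Fintype P] (M : Market N P L Ξ) (y z : Decision P L) : ℝ :=
  ∑ i : P, ((M.c i + M.δp i) * max (z (Sum.inl i) - y (Sum.inl i)) 0
    - (M.c i - M.δm i) * max (-(z (Sum.inl i) - y (Sum.inl i))) 0)

/-- The standing convexity assumption. The costs `f1` and `f2` are finite everywhere, and `f2` does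
not depend on the scenario other than through its arguments, so that the only measurability to be
required is that of the available quantities, through which the scenario enters the model. -/
structure ConvexityAssumption [Fintype P] [MeasurableSpace Ξ] (M : Market N P L Ξ)
    (ℙ : Measure Ξ) : Prop where
  measurable_avail : ∀ i, Measurable (M.Xavail i)
  convex_C1 : Convex ℝ M.C1
  closed_C1 : IsClosed M.C1
  nonempty_C1 : M.C1.Nonempty
  convex_C2 : ∀ᵐ ξ ∂ℙ, Convex ℝ (M.C2 ξ)
  closed_C2 : ∀ᵐ ξ ∂ℙ, IsClosed (M.C2 ξ)
  nonempty_C2 : ∀ᵐ ξ ∂ℙ, (M.C2 ξ).Nonempty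
  convex_f1 : ConvexOn ℝ Set.univ M.f1
  convex_f2 : ConvexOn ℝ Set.univ (fun p : Decision P L × Decision P L => M.f2 p.1 p.2)

/-- Second-stage value function: `+∞` if the real-time problem is infeasible. -/
def H [DecidableEq N] [Fintype P] (M : Market N P L Ξ) (y : Decision P L) (ξ : Ξ) : EReal :=
  ⨅ z ∈ {z : Decision P L | z ∈ M.C2 ξ ∧ ∀ i, M.g2 y z i = 0}, ((M.f2 y z : ℝ) : EReal)

open Classical in
/-- Extended-valued cost of the day-ahead decision `y` in scenario `ξ`. -/
def phi [DecidableEq N] [Fintype P] (M : Market N P L Ξ) (y : Decision P L) (ξ : Ξ) : EReal :=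
  if y ∈ M.C1 ∧ ∀ i, M.g1 y i = 0 then ((M.f1 y : ℝ) : EReal) + M.H y ξ else ⊤

section Problems

variable [DecidableEq N] [Fintype P] [MeasurableSpace Ξ] (M : Market N P L Ξ) (ℙ : Measure Ξ)

/-- Feasible set of the mean-vector formulation: essentially bounded scenario-dependent day-ahead
decisions that agree almost surely with their mean. -/
def feasibleMV {N P : Type*} [Fintype P] {L : Finset (N × N)} {Ξ : Type*} [MeasurableSpace Ξ]
    (ℙ : Measure Ξ) : Set (Ξ → Decision P L) :=
  {y | MemLp y ⊤ ℙ ∧ ∀ᵐ ξ ∂ℙ, y ξ - ∫ ξ', y ξ' ∂ℙ = 0}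

/-- Objective of the mean-vector formulation. -/
def objectiveMV (y : Ξ → Decision P L) : EReal :=
  expectE ℙ fun ξ => M.phi (y ξ) ξ

/-- Optimal value of the mean-vector formulation. -/
def valueMV : EReal :=
  ⨅ y ∈ feasibleMV (P := P) (L := L) ℙ, M.objectiveMV ℙ y

/-- `y` is an optimal solution of the mean-vector formulation. -/
def IsOptimalMV (y : Ξ → Decision P L) : Prop :=
  y ∈ feasibleMV ℙ ∧ ∀ y' ∈ feasibleMV ℙ, M.objectiveMV ℙ y ≤ M.objectiveMV ℙ y'

/-- Dual objective: the infimum over all essentially bounded `y` of the Lagrangian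
`E[φ(y(ξ), ξ) + ⟨μ(ξ) - E[μ], y(ξ)⟩]`. -/
def dualObjective (μ : Ξ → Decision P L) : EReal :=
  ⨅ y ∈ {y : Ξ → Decision P L | MemLp y ⊤ ℙ},
    expectE ℙ fun ξ => M.phi (y ξ) ξ + ((inner ℝ (μ ξ - ∫ ξ', μ ξ' ∂ℙ) (y ξ) : ℝ) : EReal)

/-- Stochastic Lagrangian `𝕃(μ, ξ) = sup_y { ⟨μ(ξ) - E[μ], y⟩ - φ(y, ξ) }`. -/
def stochLagrangian (μ : Ξ → Decision P L) (ξ : Ξ) : EReal :=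
  ⨆ y : Decision P L, ((inner ℝ (μ ξ - ∫ ξ', μ ξ' ∂ℙ) y : ℝ) : EReal) - M.phi y ξ

end Problems

end Market

end

open Filter Topology

/-! ### Partial infima and separation from a closed convex set -/

noncomputable section

/-! The scenario enters only through the available quantities, so `φ(y, ξ) = ψ(y, X(ξ)) - B` with `ψ
≥ 0` jointly lower semicontinuous, convex in `y`, and infinite outside a ball of radius `R`
(`exists_integrand`). An a.s. constant decision has zero pairing with `μ - E[μ]`, which gives weak
duality.

For strong duality, perturb in `L²`: `v(u) = inf_y E[ψ(y + u(ξ), X(ξ))]`. Its epigraph is convex,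
and it is closed because the ball bounds the constants `y`, so that compactness and Fatou's lemma
apply. No constraint qualification is needed. Any `a` below the optimal value is separated from the
epigraph at `u = 0`, and the separating functional is some `m ∈ L² ⊆ L¹`. Translating `u` by a
constant does not change `v`, which forces `E[m] = 0` (`exists_L2_multiplier`).

It remains to move the infimum inside the expectation. A small multiple of `‖y‖²` makes the
pointwise minimizer unique, hence measurable (`exists_measurable_almost_minimizer`). Evaluating the
separation inequality at this selection bounds `E[inf_y (ψ + ⟨m, y⟩)]` from below by `a`, up to `ε`.
This gives the chain value `≤ sup -E[𝕃] ≤ sup` dual `≤` value. The multiplier depends on `a`;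
attainment of the dual is not claimed. -/

theorem lowerSemicontinuous_biInf_of_isCompact {X Y : Type*} [TopologicalSpace X]
    [TopologicalSpace Y] {F : X → Y → ℝ≥0∞}
    (hF : LowerSemicontinuous fun p : X × Y => F p.1 p.2) {K : Set Y} (hK : IsCompact K) :
    LowerSemicontinuous fun x => ⨅ y ∈ K, F x y := by
  rcases K.eq_empty_or_nonempty with rfl | hne
  · simpa using lowerSemicontinuous_const
  rw [lowerSemicontinuous_iff_isClosed_preimage]
  intro a
  have : CompactSpace K := isCompact_iff_compactSpace.mp hK
  have hG : LowerSemicontinuous fun p : X × K => F p.1 p.2 :=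
    hF.comp (g := fun p : X × K => (p.1, (p.2 : Y))) (by fun_prop)
  -- Projection along a compact factor is a closed map. The infimum over `K` is attained, so its
  -- sublevel set is the projection of a sublevel set of `F`.
  have := isClosedMap_fst_of_compactSpace (X := X) (Y := K) _ (hG.isClosed_preimage a)
  convert this using 1
  ext x
  simp only [Set.mem_preimage, Set.mem_Iic, Set.mem_image, Prod.exists, exists_and_right,
    exists_eq_right]
  constructor
  · intro h
    have hx : LowerSemicontinuous fun y => F x y := hF.comp (g := fun y => (x, y)) (by fun_prop)
    obtain ⟨y, hy, hmin⟩ := (hx.lowerSemicontinuousOn K).exists_isMinOn hne hK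
    exact ⟨⟨y, hy⟩, (le_iInf₂ (f := fun y (_ : y ∈ K) => F x y) fun z hz => hmin hz).trans h⟩
  · rintro ⟨y, hy⟩
    exact (iInf₂_le y.1 y.2).trans hy

theorem exists_inner_add_mul {G : Type*} [NormedAddCommGroup G] [InnerProductSpace ℝ G]
    [CompleteSpace G] (f : StrongDual ℝ (G × ℝ)) :
    ∃ (q : G) (β : ℝ), ∀ u r, f (u, r) = inner ℝ q u + r * β := by
  refine ⟨(InnerProductSpace.toDual ℝ G).symm (f.comp (ContinuousLinearMap.inl ℝ G ℝ)),
    f (0, 1), fun u r => ?_⟩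
  rw [InnerProductSpace.toDual_symm_apply, ← smul_eq_mul, ← map_smul,
    ContinuousLinearMap.comp_apply, ← map_add]
  simp

theorem exists_affine_minorant_of_notMem {G : Type*} [NormedAddCommGroup G]
    [InnerProductSpace ℝ G] [CompleteSpace G] {S : Set (G × ℝ)} (hS : Convex ℝ S)
    (hS' : IsClosed S) {a r₀ : ℝ} (ha : ((0 : G), a) ∉ S) (hr₀ : ((0 : G), r₀) ∈ S)
    (har₀ : a < r₀) : ∃ m : G, ∀ u r, (u, r) ∈ S → a ≤ r + inner ℝ m u := by
  obtain ⟨f, c, hfa, hfS⟩ := geometric_hahn_banach_point_closed hS hS' ha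
  obtain ⟨q, β, hf⟩ := exists_inner_add_mul f
  rw [hf, inner_zero_right, zero_add] at hfa
  -- `(0, r₀)` lies straight above `(0, a)`, so the separating hyperplane is not vertical and one
  -- may divide by `β`.
  have hβ : 0 < β := by
    have h1 := hfS _ hr₀
    rw [hf, inner_zero_right, zero_add] at h1
    by_contra! hle
    nlinarith
  refine ⟨β⁻¹ • q, fun u r hp => ?_⟩
  have h2 := hfa.trans (hfS (u, r) hp)
  rw [hf] at h2
  rw [real_inner_smul_left]
  have h5 := mul_le_mul_of_nonneg_left h2.le (inv_pos.2 hβ).le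
  rw [mul_add, mul_comm a, mul_comm r, inv_mul_cancel_left₀ hβ.ne',
    inv_mul_cancel_left₀ hβ.ne'] at h5
  linarith

/-! ### Perturbation in `L²` and the mean-zero multiplier -/

section Duality

set_option linter.unusedSectionVars false

variable {Ξ E W : Type*} [MeasurableSpace Ξ] {ℙ : Measure Ξ} [IsProbabilityMeasure ℙ]
  [NormedAddCommGroup E] [InnerProductSpace ℝ E] [FiniteDimensional ℝ E] [MeasurableSpace E]
  [BorelSpace E] [TopologicalSpace W] [SecondCountableTopology W] [MeasurableSpace W]
  [BorelSpace W] {ψ : E → W → ℝ≥0∞} {X : Ξ → W} {R : ℝ}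

theorem aemeasurable_integrand (hψ : LowerSemicontinuous fun p : E × W => ψ p.1 p.2)
    (hX : Measurable X) {w : Ξ → E} (hw : AEMeasurable w ℙ) :
    AEMeasurable (fun ξ => ψ (w ξ) (X ξ)) ℙ :=
  hψ.measurable.comp_aemeasurable (hw.prodMk hX.aemeasurable)

theorem ae_norm_le_of_lintegral_ne_top (hψ : LowerSemicontinuous fun p : E × W => ψ p.1 p.2)
    (hX : Measurable X) (hR : ∀ y w, R < ‖y‖ → ψ y w = ⊤) {w : Ξ → E} (hw : AEMeasurable w ℙ)
    (h : ∫⁻ ξ, ψ (w ξ) (X ξ) ∂ℙ ≠ ⊤) : ∀ᵐ ξ ∂ℙ, ‖w ξ‖ ≤ R := by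
  filter_upwards [ae_lt_top' (aemeasurable_integrand hψ hX hw) h] with ξ hξ
  by_contra! hlt
  exact hξ.ne (hR _ _ hlt)

/-- Perturbations of the integrand paired with upper bounds of the perturbed optimal value. -/
def perturbationEpigraph (ℙ : Measure Ξ) (ψ : E → W → ℝ≥0∞) (X : Ξ → W) : Set (Lp E 2 ℙ × ℝ) :=
  {p | 0 ≤ p.2 ∧ ∃ y : E, ∫⁻ ξ, ψ (y + p.1 ξ) (X ξ) ∂ℙ ≤ ENNReal.ofReal p.2}

theorem convex_perturbationEpigraph (hψ : LowerSemicontinuous fun p : E × W => ψ p.1 p.2)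
    (hconv : ∀ w y₁ y₂, ∀ a b : ℝ, 0 ≤ a → 0 ≤ b → a + b = 1 →
      ψ (a • y₁ + b • y₂) w ≤ ENNReal.ofReal a * ψ y₁ w + ENNReal.ofReal b * ψ y₂ w)
    (hX : Measurable X) : Convex ℝ (perturbationEpigraph ℙ ψ X) := by
  rintro ⟨u₁, r₁⟩ ⟨hr₁, y₁, h₁⟩ ⟨u₂, r₂⟩ ⟨hr₂, y₂, h₂⟩ a b ha hb hab
  refine ⟨by simp only [Prod.snd_add, Prod.smul_snd, smul_eq_mul] at *; positivity,
    a • y₁ + b • y₂, ?_⟩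
  simp only [Prod.snd_add, Prod.smul_snd, smul_eq_mul, Prod.fst_add, Prod.smul_fst] at *
  have hm : ∀ (y : E) (u : Lp E 2 ℙ), AEMeasurable (fun ξ => ψ (y + u ξ) (X ξ)) ℙ := fun y u =>
    aemeasurable_integrand hψ hX ((Lp.aestronglyMeasurable u).aemeasurable.const_add y)
  calc ∫⁻ ξ, ψ (a • y₁ + b • y₂ + (a • u₁ + b • u₂ : Lp E 2 ℙ) ξ) (X ξ) ∂ℙ
      ≤ ∫⁻ ξ, ENNReal.ofReal a * ψ (y₁ + u₁ ξ) (X ξ)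
          + ENNReal.ofReal b * ψ (y₂ + u₂ ξ) (X ξ) ∂ℙ := by
        refine lintegral_mono_ae ?_
        filter_upwards [Lp.coeFn_add (a • u₁) (b • u₂), Lp.coeFn_smul a u₁, Lp.coeFn_smul b u₂]
          with ξ e₁ e₂ e₃
        refine le_of_eq_of_le ?_ (hconv (X ξ) (y₁ + u₁ ξ) (y₂ + u₂ ξ) a b ha hb hab)
        rw [e₁, Pi.add_apply, e₂, e₃, Pi.smul_apply, Pi.smul_apply]
        congr 1
        module
    _ = ENNReal.ofReal a * ∫⁻ ξ, ψ (y₁ + u₁ ξ) (X ξ) ∂ℙ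
          + ENNReal.ofReal b * ∫⁻ ξ, ψ (y₂ + u₂ ξ) (X ξ) ∂ℙ := by
        rw [lintegral_add_left' ((hm y₁ u₁).const_mul _), lintegral_const_mul'' _ (hm y₁ u₁),
          lintegral_const_mul'' _ (hm y₂ u₂)]
    _ ≤ ENNReal.ofReal a * ENNReal.ofReal r₁ + ENNReal.ofReal b * ENNReal.ofReal r₂ := by
        gcongr
    _ = ENNReal.ofReal (a * r₁ + b * r₂) := by
        rw [ENNReal.ofReal_add (by positivity) (by positivity), ENNReal.ofReal_mul ha,
          ENNReal.ofReal_mul hb]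

/-- A subsequence of the perturbations converges almost everywhere. Since `ψ` is infinite outside
the ball, a single good scenario `ξ₀` already bounds the constants `y n`. A limit point of these is
then admissible by lower semicontinuity and Fatou's lemma. -/
theorem isClosed_perturbationEpigraph (hψ : LowerSemicontinuous fun p : E × W => ψ p.1 p.2)
    (hX : Measurable X) (hR : ∀ y w, R < ‖y‖ → ψ y w = ⊤) :
    IsClosed (perturbationEpigraph ℙ ψ X) := by
  refine IsSeqClosed.isClosed ?_
  rintro p ⟨u, r⟩ hp hlim
  have hu : Tendsto (fun n => (p n).1) atTop (𝓝 u) := (continuous_fst.tendsto _).comp hlim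
  have hr : Tendsto (fun n => (p n).2) atTop (𝓝 r) := (continuous_snd.tendsto _).comp hlim
  refine ⟨ge_of_tendsto' hr fun n => (hp n).1, ?_⟩
  choose h0 y hy using hp
  obtain ⟨σ, hσ, hae⟩ := (tendstoInMeasure_of_tendsto_Lp hu).exists_seq_tendsto_ae
  have hb : ∀ᵐ ξ ∂ℙ, ∀ n, ‖y n + (p n).1 ξ‖ ≤ R := ae_all_iff.2 fun n =>
    ae_norm_le_of_lintegral_ne_top hψ hX hR
      ((Lp.aestronglyMeasurable (p n).1).aemeasurable.const_add (y n))
      ((hy n).trans_lt ENNReal.ofReal_lt_top).ne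
  obtain ⟨ξ₀, hξ₀, hbξ₀⟩ := (hae.and hb).exists
  obtain ⟨C, hC⟩ := (Metric.isBounded_range_of_tendsto _ hξ₀).exists_norm_le
  have hyb : ∀ n, y (σ n) ∈ Metric.closedBall (0 : E) (R + C) := fun n => by
    rw [mem_closedBall_zero_iff]
    have h1 := hC _ (Set.mem_range_self n)
    have h2 := norm_sub_le (y (σ n) + (p (σ n)).1 ξ₀) ((p (σ n)).1 ξ₀)
    rw [add_sub_cancel_right] at h2
    linarith [hbξ₀ (σ n)]
  obtain ⟨y', -, τ, hτ, hy'⟩ := (isCompact_closedBall (0 : E) (R + C)).tendsto_subseq hyb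
  refine ⟨y', ?_⟩
  have hm : ∀ n, AEMeasurable (fun ξ => ψ (y (σ (τ n)) + (p (σ (τ n))).1 ξ) (X ξ)) ℙ := fun n =>
    aemeasurable_integrand hψ hX ((Lp.aestronglyMeasurable _).aemeasurable.const_add _)
  calc ∫⁻ ξ, ψ (y' + u ξ) (X ξ) ∂ℙ
      ≤ ∫⁻ ξ, liminf (fun n => ψ (y (σ (τ n)) + (p (σ (τ n))).1 ξ) (X ξ)) atTop ∂ℙ := by
        refine lintegral_mono_ae ?_
        filter_upwards [hae] with ξ hξ
        have ht : Tendsto (fun n => (y (σ (τ n)) + (p (σ (τ n))).1 ξ, X ξ)) atTop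
            (𝓝 (y' + u ξ, X ξ)) :=
          (hy'.add (hξ.comp hτ.tendsto_atTop)).prodMk_nhds tendsto_const_nhds
        refine le_of_forall_lt fun c hc => ?_
        obtain ⟨c', hcc', hc'⟩ := exists_between hc
        refine hcc'.trans_le (le_liminf_of_le ?_ ?_)
        · isBoundedDefault
        · exact (ht.eventually (hψ _ c' hc')).mono fun n hn => le_of_lt hn
    _ ≤ liminf (fun n => ∫⁻ ξ, ψ (y (σ (τ n)) + (p (σ (τ n))).1 ξ) (X ξ) ∂ℙ) atTop :=
        lintegral_liminf_le' hm
    _ ≤ liminf (fun n => ENNReal.ofReal (p (σ (τ n))).2) atTop :=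
        liminf_le_liminf (Eventually.of_forall fun n => hy _)
    _ = ENNReal.ofReal r :=
        ((ENNReal.continuous_ofReal.tendsto r).comp
          (hr.comp (hσ.tendsto_atTop.comp hτ.tendsto_atTop))).liminf_eq

theorem inner_integral_eq_inner_const (m : Lp E 2 ℙ) (y : E) :
    inner ℝ (∫ ξ, m ξ ∂ℙ) y = inner ℝ m (Lp.const 2 ℙ y) := by
  rw [L2.inner_def, real_inner_comm, ← integral_inner ((Lp.memLp _).integrable (by norm_num))]
  refine integral_congr_ae ?_
  filter_upwards [Lp.coeFn_const 2 ℙ y] with ξ e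
  rw [e, Function.const_apply, real_inner_comm]

theorem lintegral_integrand_const (y : E) :
    ∫⁻ ξ, ψ ((Lp.const 2 ℙ y : Lp E 2 ℙ) ξ) (X ξ) ∂ℙ = ∫⁻ ξ, ψ y (X ξ) ∂ℙ := by
  refine lintegral_congr_ae ?_
  filter_upwards [Lp.coeFn_const 2 ℙ y] with ξ e
  rw [e, Function.const_apply]

theorem lintegral_integrand_add_zero (y : E) :
    ∫⁻ ξ, ψ (y + (0 : Lp E 2 ℙ) ξ) (X ξ) ∂ℙ = ∫⁻ ξ, ψ y (X ξ) ∂ℙ := by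
  refine lintegral_congr_ae ?_
  filter_upwards [Lp.coeFn_zero E 2 ℙ] with ξ hξ
  rw [hξ, Pi.zero_apply, add_zero]

theorem sub_const_mem_perturbationEpigraph {w : Lp E 2 ℙ} (y : E) {r : ℝ} (hr : 0 ≤ r)
    (hw : ∫⁻ ξ, ψ (w ξ) (X ξ) ∂ℙ ≤ ENNReal.ofReal r) :
    (w - Lp.const 2 ℙ y, r) ∈ perturbationEpigraph ℙ ψ X := by
  refine ⟨hr, y, le_of_eq_of_le (lintegral_congr_ae ?_) hw⟩
  filter_upwards [Lp.coeFn_sub w (Lp.const 2 ℙ y), Lp.coeFn_const 2 ℙ y] with ξ e₁ e₂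
  simp only [e₁, Pi.sub_apply, e₂, Function.const_apply, add_sub_cancel]

/-- The constant `y` in the perturbed problem is free, so the affine minorant holds at `w - y` for
every constant `y`. A linear function of `y` that is bounded on one side vanishes, hence `E[m] = 0`.
-/
theorem exists_L2_multiplier (hψ : LowerSemicontinuous fun p : E × W => ψ p.1 p.2)
    (hconv : ∀ w y₁ y₂, ∀ a b : ℝ, 0 ≤ a → 0 ≤ b → a + b = 1 →
      ψ (a • y₁ + b • y₂) w ≤ ENNReal.ofReal a * ψ y₁ w + ENNReal.ofReal b * ψ y₂ w)
    (hX : Measurable X) (hR : ∀ y w, R < ‖y‖ → ψ y w = ⊤) {a : ℝ}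
    (ha : ∀ y, ENNReal.ofReal a < ∫⁻ ξ, ψ y (X ξ) ∂ℙ) {y₀ : E}
    (hy₀ : ∫⁻ ξ, ψ y₀ (X ξ) ∂ℙ ≠ ⊤) :
    ∃ m : Lp E 2 ℙ, ∫ ξ, m ξ ∂ℙ = 0 ∧ ∀ (w : Lp E 2 ℙ) (r : ℝ), 0 ≤ r →
      ∫⁻ ξ, ψ (w ξ) (X ξ) ∂ℙ ≤ ENNReal.ofReal r → a ≤ r + inner ℝ m w := by
  obtain ⟨r₀, hr₀, hr₀eq⟩ : ∃ r₀ : ℝ, 0 ≤ r₀ ∧ ∫⁻ ξ, ψ y₀ (X ξ) ∂ℙ = ENNReal.ofReal r₀ :=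
    ⟨_, ENNReal.toReal_nonneg, (ENNReal.ofReal_toReal hy₀).symm⟩
  have har₀ : a < r₀ := by
    have := ha y₀
    rw [hr₀eq] at this
    exact (ENNReal.ofReal_lt_ofReal_iff'.1 this).1
  have hnot : ((0 : Lp E 2 ℙ), a) ∉ perturbationEpigraph ℙ ψ X := by
    rintro ⟨-, y, hy⟩
    rw [lintegral_integrand_add_zero] at hy
    exact absurd hy (ha y).not_ge
  have hmem : ((0 : Lp E 2 ℙ), r₀) ∈ perturbationEpigraph ℙ ψ X :=
    ⟨hr₀, y₀, by rw [lintegral_integrand_add_zero, hr₀eq]⟩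
  have hcvx := convex_perturbationEpigraph (ℙ := ℙ) hψ hconv hX
  have hcl := isClosed_perturbationEpigraph (ℙ := ℙ) hψ hX hR
  have hex := @exists_affine_minorant_of_notMem (Lp E 2 ℙ) _ _ _ (perturbationEpigraph ℙ ψ X)
    hcvx hcl a r₀ hnot hmem har₀
  obtain ⟨m, hm⟩ := hex
  have key : ∀ (w : Lp E 2 ℙ) (y : E) (r : ℝ), 0 ≤ r →
      ∫⁻ ξ, ψ (w ξ) (X ξ) ∂ℙ ≤ ENNReal.ofReal r →
      a ≤ r + inner ℝ m w - inner ℝ (∫ ξ, m ξ ∂ℙ) y := by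
    intro w y r hr hw
    have h := hm _ _ (sub_const_mem_perturbationEpigraph y hr hw)
    rw [inner_sub_right, ← inner_integral_eq_inner_const] at h
    linarith
  have hzero : ∫ ξ, m ξ ∂ℙ = 0 := by
    by_contra hne
    have hvv : 0 < inner ℝ (∫ ξ, m ξ ∂ℙ) (∫ ξ, m ξ ∂ℙ) := real_inner_self_pos.2 hne
    -- This multiple of `E[m]` is scaled so that the right-hand side of `key` becomes `a - 1`.
    have h1 := key _ (((r₀ + inner ℝ m (Lp.const 2 ℙ y₀) - a + 1)
      / inner ℝ (∫ ξ, m ξ ∂ℙ) (∫ ξ, m ξ ∂ℙ)) • ∫ ξ, m ξ ∂ℙ) r₀ hr₀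
      (lintegral_integrand_const y₀ |>.trans hr₀eq).le
    rw [real_inner_smul_right, div_mul_cancel₀ _ hvv.ne'] at h1
    linarith
  refine ⟨m, hzero, fun w r hr hw => ?_⟩
  have h := key w 0 r hr hw
  rwa [inner_zero_right, sub_zero] at h

end Duality

/-! ### Measurable almost minimizers by strictly convex regularization -/

theorem eq_of_isMin_add_sq {E : Type*} [NormedAddCommGroup E] [InnerProductSpace ℝ E]
    {g : E → ℝ≥0∞} (hg : ∀ y₁ y₂, ∀ a b : ℝ, 0 ≤ a → 0 ≤ b → a + b = 1 →
      g (a • y₁ + b • y₂) ≤ ENNReal.ofReal a * g y₁ + ENNReal.ofReal b * g y₂)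
    {δ : ℝ} (hδ : 0 < δ) {y₁ y₂ : E} (h₁ : g y₁ ≠ ⊤)
    (hy₁ : ∀ z, g y₁ + ENNReal.ofReal (δ * ‖y₁‖ ^ 2) ≤ g z + ENNReal.ofReal (δ * ‖z‖ ^ 2))
    (hy₂ : ∀ z, g y₂ + ENNReal.ofReal (δ * ‖y₂‖ ^ 2) ≤ g z + ENNReal.ofReal (δ * ‖z‖ ^ 2)) :
    y₁ = y₂ := by
  have h₂ : g y₂ ≠ ⊤ := fun h => by
    have := hy₂ y₁
    rw [h, top_add, top_le_iff] at this
    exact ENNReal.add_ne_top.2 ⟨h₁, ENNReal.ofReal_ne_top⟩ this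
  have hmid := hg y₁ y₂ (1 / 2) (1 / 2) (by norm_num) (by norm_num) (by norm_num)
  set z : E := (1 / 2 : ℝ) • y₁ + (1 / 2 : ℝ) • y₂ with hz
  have hne : ENNReal.ofReal (1 / 2) * g y₁ + ENNReal.ofReal (1 / 2) * g y₂ ≠ ⊤ :=
    ENNReal.add_ne_top.2 ⟨ENNReal.mul_ne_top ENNReal.ofReal_ne_top h₁,
      ENNReal.mul_ne_top ENNReal.ofReal_ne_top h₂⟩
  have h₃ : g z ≠ ⊤ := ne_top_of_le_ne_top hne hmid
  have hreal : ∀ {y : E}, g y ≠ ⊤ → (∀ z, g y + ENNReal.ofReal (δ * ‖y‖ ^ 2) ≤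
      g z + ENNReal.ofReal (δ * ‖z‖ ^ 2)) →
      (g y).toReal + δ * ‖y‖ ^ 2 ≤ (g z).toReal + δ * ‖z‖ ^ 2 := by
    intro y hy hmin
    have h := ENNReal.toReal_mono (ENNReal.add_ne_top.2 ⟨h₃, ENNReal.ofReal_ne_top⟩) (hmin z)
    rwa [ENNReal.toReal_add hy ENNReal.ofReal_ne_top, ENNReal.toReal_add h₃ ENNReal.ofReal_ne_top,
      ENNReal.toReal_ofReal (by positivity), ENNReal.toReal_ofReal (by positivity)] at h
  have e₁ := hreal h₁ hy₁
  have e₂ := hreal h₂ hy₂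
  have e₃ := ENNReal.toReal_mono hne hmid
  rw [ENNReal.toReal_add (ENNReal.mul_ne_top ENNReal.ofReal_ne_top h₁)
    (ENNReal.mul_ne_top ENNReal.ofReal_ne_top h₂), ENNReal.toReal_mul, ENNReal.toReal_mul,
    ENNReal.toReal_ofReal (by norm_num)] at e₃
  -- Parallelogram identity: at the midpoint the regularized function lies at least `δ‖y₁ - y₂‖² /
  -- 4` below the average of its two minimal values.
  have hpar : ‖z‖ ^ 2 = ‖y₁‖ ^ 2 / 2 + ‖y₂‖ ^ 2 / 2 - ‖y₁ - y₂‖ ^ 2 / 4 := by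
    rw [hz, ← smul_add, norm_smul, mul_pow, norm_add_sq_real, norm_sub_sq_real]
    norm_num
    ring
  rw [hpar] at e₁ e₂
  have h0 : δ * ‖y₁ - y₂‖ ^ 2 ≤ 0 := by nlinarith
  have h4 : ‖y₁ - y₂‖ ^ 2 ≤ 0 := nonpos_of_mul_nonpos_right h0 hδ
  have h5 : ‖y₁ - y₂‖ = 0 := by
    have := sq_nonneg ‖y₁ - y₂‖
    exact pow_eq_zero_iff two_ne_zero |>.1 (le_antisymm h4 this)
  exact sub_eq_zero.1 (norm_eq_zero.1 h5)

section Selection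

variable {E W : Type*} [NormedAddCommGroup E] [InnerProductSpace ℝ E] [FiniteDimensional ℝ E]
  [MeasurableSpace E] [BorelSpace E] [TopologicalSpace W] [MeasurableSpace W]
  [BorelSpace W] {ψ : E → W → ℝ≥0∞} {R : ℝ}

omit [InnerProductSpace ℝ E] [FiniteDimensional ℝ E] in
theorem measurable_piecewise_of_unique_isMinOn {θ : W → E → ℝ≥0∞}
    (hθ : LowerSemicontinuous fun p : W × E => θ p.1 p.2) {K : Set E} (hK : IsCompact K)
    {A : Set W} [∀ w, Decidable (w ∈ A)] (hA : MeasurableSet A) {s : W → E}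
    (hsK : ∀ w ∈ A, s w ∈ K) (hsfin : ∀ w ∈ A, θ w (s w) ≠ ⊤)
    (hsmin : ∀ w ∈ A, ∀ z ∈ K, θ w (s w) ≤ θ w z)
    (huniq : ∀ w ∈ A, ∀ y ∈ K, (∀ z ∈ K, θ w y ≤ θ w z) → y = s w) (y₀ : E) :
    Measurable (A.piecewise s fun _ => y₀) := by
  refine measurable_of_isClosed fun B hB => ?_
  have hinf : ∀ K : Set E, IsCompact K → Measurable fun w => ⨅ y ∈ K, θ w y := fun K hK =>
    (lowerSemicontinuous_biInf_of_isCompact hθ hK).measurable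
  have hθw : ∀ w, LowerSemicontinuous (θ w) := fun w =>
    hθ.comp (g := fun y : E => (w, y)) (by fun_prop)
  have hKB : IsCompact (K ∩ B) := hK.inter_right hB
  -- By uniqueness, the minimizer lies in `B` exactly when restricting to `K ∩ B` does not raise the
  -- infimum. Both infima are lower semicontinuous in `w`. Finiteness of the minimum rules out an
  -- empty `K ∩ B`, whose infimum is `⊤`.
  have hset : (A.piecewise s fun _ => y₀) ⁻¹' B = A.ite
      {w | ⨅ y ∈ K ∩ B, θ w y ≤ ⨅ y ∈ K, θ w y} {_w | y₀ ∈ B} := by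
    rw [Set.piecewise_preimage]
    ext w
    simp only [Set.ite, Set.mem_union, Set.mem_inter_iff, Set.mem_sdiff, Set.mem_preimage,
      Set.mem_ofPred_eq]
    refine or_congr (and_congr_left fun hw => ⟨fun h => ?_, fun h => ?_⟩) Iff.rfl
    · exact (iInf₂_le (f := fun y (_ : y ∈ K ∩ B) => θ w y) (s w) ⟨hsK w hw, h⟩).trans
        (le_iInf₂ fun z hz => hsmin w hw z hz)
    · have hle : ⨅ y ∈ K ∩ B, θ w y ≤ θ w (s w) :=
        h.trans (iInf₂_le (f := fun y (_ : y ∈ K) => θ w y) (s w) (hsK w hw))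
      rcases (K ∩ B).eq_empty_or_nonempty with he | hne
      · simp only [he, Set.mem_empty_iff_false, iInf_false, iInf_top, top_le_iff] at hle
        exact absurd hle (hsfin w hw)
      obtain ⟨y, hyB, hy⟩ := ((hθw w).lowerSemicontinuousOn _).exists_isMinOn hne hKB
      have hyle : θ w y ≤ θ w (s w) :=
        (le_iInf₂ (f := fun y (_ : y ∈ K ∩ B) => θ w y) fun z hz => hy hz).trans hle
      rw [← huniq w hw y hyB.1 fun z hz => hyle.trans (hsmin w hw z hz)]
      exact hyB.2
  rw [hset]
  exact hA.ite (measurableSet_le (hinf _ hKB) (hinf _ hK)) (MeasurableSet.const _)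

/-- Minimizing `ψ + δ‖y‖²` instead of `ψ` gives a unique, hence measurable, minimizer. The price is
at most `δR² ≤ ε`, because finite values occur only in the ball. -/
theorem exists_measurable_almost_minimizer
    (hψ : LowerSemicontinuous fun p : E × W => ψ p.1 p.2)
    (hconv : ∀ w y₁ y₂, ∀ a b : ℝ, 0 ≤ a → 0 ≤ b → a + b = 1 →
      ψ (a • y₁ + b • y₂) w ≤ ENNReal.ofReal a * ψ y₁ w + ENNReal.ofReal b * ψ y₂ w)
    (hR : ∀ y w, R < ‖y‖ → ψ y w = ⊤) (y₀ : E) {ε : ℝ} (hε : 0 < ε) :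
    ∃ s : W → E, Measurable s ∧
      ∀ w, ψ y₀ w ≠ ⊤ → ψ (s w) w ≤ (⨅ y, ψ y w) + ENNReal.ofReal ε := by
  obtain ⟨δ, hδ, hδε⟩ : ∃ δ : ℝ, 0 < δ ∧ δ * R ^ 2 ≤ ε := by
    refine ⟨ε / (R ^ 2 + 1), by positivity, ?_⟩
    rw [div_mul_eq_mul_div, div_le_iff₀ (by positivity)]
    nlinarith
  set θ : W → E → ℝ≥0∞ := fun w y => ψ y w + ENNReal.ofReal (δ * ‖y‖ ^ 2) with hθdef
  have hθ : LowerSemicontinuous fun p : W × E => θ p.1 p.2 := by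
    have h1 : LowerSemicontinuous fun p : W × E => ψ p.2 p.1 :=
      hψ.comp (g := fun p : W × E => (p.2, p.1)) (by fun_prop)
    have h2 : Continuous fun p : W × E => ENNReal.ofReal (δ * ‖p.2‖ ^ 2) :=
      ENNReal.continuous_ofReal.comp (by fun_prop)
    exact h1.add h2.lowerSemicontinuous
  have hball : ∀ {w y}, ψ y w ≠ ⊤ → y ∈ Metric.closedBall (0 : E) R := by
    intro w y h
    rw [mem_closedBall_zero_iff]
    by_contra! hlt
    exact h (hR y w hlt)
  set A : Set W := {w | ψ y₀ w ≠ ⊤} with hA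
  have hAm : MeasurableSet A := by
    have h1 : LowerSemicontinuous fun w => ψ y₀ w :=
      hψ.comp (g := fun w : W => (y₀, w)) (by fun_prop)
    have : A = (fun w => ψ y₀ w) ⁻¹' {⊤}ᶜ := rfl
    rw [this]
    exact h1.measurable (measurableSet_singleton _).compl
  have hθw : ∀ w, LowerSemicontinuous (θ w) := fun w =>
    hθ.comp (g := fun y : E => (w, y)) (by fun_prop)
  have hmin : ∀ w ∈ A, ∃ y, ψ y w ≠ ⊤ ∧ ∀ z, θ w y ≤ θ w z := by
    intro w hw
    obtain ⟨y, -, hy⟩ := ((hθw w).lowerSemicontinuousOn _).exists_isMinOn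
      ⟨y₀, hball hw⟩ (isCompact_closedBall (0 : E) R)
    have hle : ∀ z, θ w y ≤ θ w z := by
      intro z
      by_cases hz : ψ z w = ⊤
      · simp [θ, hz]
      · exact hy (hball hz)
    refine ⟨y, fun htop => ?_, hle⟩
    have := hle y₀
    simp only [hθdef, htop, top_add, top_le_iff] at this
    exact ENNReal.add_ne_top.2 ⟨hw, ENNReal.ofReal_ne_top⟩ this
  classical
  choose! s hsfin hsmin using hmin
  refine ⟨A.piecewise s fun _ => y₀, ?_, ?_⟩
  · refine measurable_piecewise_of_unique_isMinOn hθ (isCompact_closedBall (0 : E) R) hAm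
      (fun w hw => hball (hsfin w hw))
      (fun w hw => ENNReal.add_ne_top.2 ⟨hsfin w hw, ENNReal.ofReal_ne_top⟩)
      (fun w hw z _ => hsmin w hw z) (fun w hw y _ hy => ?_) y₀
    exact (eq_of_isMin_add_sq (hconv w) hδ (hsfin w hw) (hsmin w hw)
      (fun z => (hy _ (hball (hsfin w hw))).trans (hsmin w hw z))).symm
  · intro w hw
    rw [Set.piecewise_eq_of_mem _ _ _ hw, ENNReal.iInf_add]
    refine le_iInf fun y => ?_
    by_cases hy : ψ y w = ⊤
    · simp [hy]
    have h1 : ψ (s w) w ≤ θ w (s w) := le_self_add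
    refine (h1.trans (hsmin w hw y)).trans ?_
    simp only [hθdef]
    gcongr
    refine le_trans ?_ hδε
    have := mem_closedBall_zero_iff.1 (hball hy)
    gcongr

end Selection

/-! ### Interchange of infimum and expectation -/

section Interchange

set_option linter.unusedSectionVars false

variable {Ξ E W : Type*} [MeasurableSpace Ξ] {ℙ : Measure Ξ} [IsProbabilityMeasure ℙ]
  [NormedAddCommGroup E] [InnerProductSpace ℝ E] [FiniteDimensional ℝ E] [MeasurableSpace E]
  [BorelSpace E] [TopologicalSpace W] [SecondCountableTopology W] [MeasurableSpace W]
  [BorelSpace W] {ψ : E → W → ℝ≥0∞} {X : Ξ → W} {R : ℝ}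

/-- The integrand `ψ` tilted by the linear functional `⟪n, ·⟫`, shifted so as to be nonnegative on
the ball of radius `R`. -/
def tilt (ψ : E → W → ℝ≥0∞) (R : ℝ) (y : E) (p : W × E) : ℝ≥0∞ :=
  ψ y p.1 + ENNReal.ofReal (inner ℝ p.2 y + R * ‖p.2‖)

theorem lowerSemicontinuous_tilt (hψ : LowerSemicontinuous fun p : E × W => ψ p.1 p.2) :
    LowerSemicontinuous fun p : E × (W × E) => tilt ψ R p.1 p.2 := by
  have h1 : LowerSemicontinuous fun p : E × (W × E) => ψ p.1 p.2.1 :=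
    hψ.comp (g := fun p : E × (W × E) => (p.1, p.2.1)) (by fun_prop)
  have h2 : Continuous fun p : E × (W × E) =>
      ENNReal.ofReal (inner ℝ p.2.2 p.1 + R * ‖p.2.2‖) :=
    ENNReal.continuous_ofReal.comp (by fun_prop)
  exact h1.add h2.lowerSemicontinuous

theorem tilt_convex (hconv : ∀ w y₁ y₂, ∀ a b : ℝ, 0 ≤ a → 0 ≤ b → a + b = 1 →
      ψ (a • y₁ + b • y₂) w ≤ ENNReal.ofReal a * ψ y₁ w + ENNReal.ofReal b * ψ y₂ w)
    (p : W × E) (y₁ y₂ : E) (a b : ℝ) (ha : 0 ≤ a) (hb : 0 ≤ b) (hab : a + b = 1) :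
    tilt ψ R (a • y₁ + b • y₂) p
      ≤ ENNReal.ofReal a * tilt ψ R y₁ p + ENNReal.ofReal b * tilt ψ R y₂ p := by
  have h1 : inner ℝ p.2 (a • y₁ + b • y₂) + R * ‖p.2‖
      = a * (inner ℝ p.2 y₁ + R * ‖p.2‖) + b * (inner ℝ p.2 y₂ + R * ‖p.2‖) := by
    rw [inner_add_right, real_inner_smul_right, real_inner_smul_right]
    linear_combination (-(R * ‖p.2‖)) * hab
  have h2 := ENNReal.ofReal_add_le (p := a * (inner ℝ p.2 y₁ + R * ‖p.2‖))
    (q := b * (inner ℝ p.2 y₂ + R * ‖p.2‖))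
  rw [← h1, ENNReal.ofReal_mul ha, ENNReal.ofReal_mul hb] at h2
  calc tilt ψ R (a • y₁ + b • y₂) p ≤ _ := add_le_add (hconv p.1 y₁ y₂ a b ha hb hab) h2
    _ = _ := by simp only [tilt]; ring

theorem tilt_eq_top (hR : ∀ y w, R < ‖y‖ → ψ y w = ⊤) (y : E) (p : W × E) (h : R < ‖y‖) :
    tilt ψ R y p = ⊤ := by
  rw [tilt, hR y p.1 h, top_add]

theorem integrable_inner_of_ae_norm_le {n w : Ξ → E} (hn : Integrable n ℙ)
    (hw : AEStronglyMeasurable w ℙ) (hwR : ∀ᵐ ξ ∂ℙ, ‖w ξ‖ ≤ R) :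
    Integrable (fun ξ => inner ℝ (n ξ) (w ξ)) ℙ := by
  refine Integrable.mono' (hn.norm.const_mul R) (hn.1.inner hw) ?_
  filter_upwards [hwR] with ξ hξ
  refine (norm_inner_le_norm _ _).trans ?_
  rw [mul_comm]
  gcongr

/-- Where `‖w‖ ≤ R`, the shift `R‖n‖` keeps the pairing nonnegative, so `ENNReal.ofReal` truncates
nothing. -/
theorem lintegral_tilt (hψ : LowerSemicontinuous fun p : E × W => ψ p.1 p.2) (hX : Measurable X)
    {n w : Ξ → E} (hn : Integrable n ℙ) (hw : AEStronglyMeasurable w ℙ)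
    (hwR : ∀ᵐ ξ ∂ℙ, ‖w ξ‖ ≤ R) :
    ∫⁻ ξ, tilt ψ R (w ξ) (X ξ, n ξ) ∂ℙ = ∫⁻ ξ, ψ (w ξ) (X ξ) ∂ℙ
      + ENNReal.ofReal (∫ ξ, inner ℝ (n ξ) (w ξ) ∂ℙ + R * ∫ ξ, ‖n ξ‖ ∂ℙ) := by
  have hi := integrable_inner_of_ae_norm_le hn hw hwR
  simp only [tilt]
  rw [lintegral_add_left' (aemeasurable_integrand hψ hX hw.aemeasurable), ← integral_const_mul,
    ← integral_add hi (hn.norm.const_mul R)]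
  congr 1
  refine (ofReal_integral_eq_lintegral_ofReal (hi.add (hn.norm.const_mul R)) ?_).symm
  filter_upwards [hwR] with ξ hξ
  have h1 := abs_le.1 (abs_real_inner_le_norm (n ξ) (w ξ))
  have h2 : ‖n ξ‖ * ‖w ξ‖ ≤ ‖n ξ‖ * R := by gcongr
  simp only [Pi.zero_apply, Pi.add_apply]
  linarith

theorem lintegral_iInf_tilt_ne_top (hψ : LowerSemicontinuous fun p : E × W => ψ p.1 p.2)
    (hX : Measurable X) (hR : ∀ y w, R < ‖y‖ → ψ y w = ⊤) {y₀ : E}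
    (hy₀ : ∫⁻ ξ, ψ y₀ (X ξ) ∂ℙ ≠ ⊤) {n : Ξ → E} (hn : Integrable n ℙ) :
    ∫⁻ ξ, ⨅ y, tilt ψ R y (X ξ, n ξ) ∂ℙ ≠ ⊤ := by
  have hy₀R := ae_norm_le_of_lintegral_ne_top hψ hX hR aemeasurable_const hy₀
  refine ne_top_of_le_ne_top ?_ (lintegral_mono fun ξ => iInf_le _ y₀)
  rw [lintegral_tilt hψ hX hn aestronglyMeasurable_const hy₀R]
  exact ENNReal.add_ne_top.2 ⟨hy₀, ENNReal.ofReal_ne_top⟩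

theorem exists_multiplier_le_lintegral_iInf_tilt
    (hψ : LowerSemicontinuous fun p : E × W => ψ p.1 p.2)
    (hconv : ∀ w y₁ y₂, ∀ a b : ℝ, 0 ≤ a → 0 ≤ b → a + b = 1 →
      ψ (a • y₁ + b • y₂) w ≤ ENNReal.ofReal a * ψ y₁ w + ENNReal.ofReal b * ψ y₂ w)
    (hX : Measurable X) (hR : ∀ y w, R < ‖y‖ → ψ y w = ⊤) {a : ℝ}
    (ha : ∀ y, ENNReal.ofReal a < ∫⁻ ξ, ψ y (X ξ) ∂ℙ) {y₀ : E}
    (hy₀ : ∫⁻ ξ, ψ y₀ (X ξ) ∂ℙ ≠ ⊤) :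
    ∃ n : Ξ → E, MemLp n 1 ℙ ∧ ∫ ξ, n ξ ∂ℙ = 0 ∧
      a ≤ (∫⁻ ξ, ⨅ y, tilt ψ R y (X ξ, n ξ) ∂ℙ).toReal - R * ∫ ξ, ‖n ξ‖ ∂ℙ := by
  obtain ⟨m, hm0, hm⟩ := exists_L2_multiplier hψ hconv hX hR ha hy₀
  have hmi : MemLp m 1 ℙ := (Lp.memLp m).mono_exponent (by norm_num)
  have hmint : Integrable m ℙ := memLp_one_iff_integrable.1 hmi
  refine ⟨m, hmi, hm0, ?_⟩
  have hXm : Measurable fun ξ => (X ξ, m ξ) := hX.prodMk (Lp.stronglyMeasurable m).measurable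
  have hy₀ae : ∀ᵐ ξ ∂ℙ, ψ y₀ (X ξ) ≠ ⊤ := by
    filter_upwards [ae_lt_top' (aemeasurable_integrand hψ hX aemeasurable_const) hy₀] with ξ hξ
      using hξ.ne
  have hTfin := lintegral_iInf_tilt_ne_top hψ hX hR hy₀ hmint
  refine le_of_forall_pos_le_add fun ε hε => ?_
  -- The parameter of the selection is the pair `(X ξ, m ξ)`. The resulting `w` is a.e. bounded by
  -- `R`, hence in `L²`, and may be inserted into the separation inequality.
  obtain ⟨s, hs, hsle⟩ := exists_measurable_almost_minimizer
    (lowerSemicontinuous_tilt (R := R) hψ) (tilt_convex hconv) (tilt_eq_top hR) y₀ hε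
  set w : Ξ → E := fun ξ => s (X ξ, m ξ) with hwdef
  have hw : Measurable w := hs.comp hXm
  have hle : ∫⁻ ξ, tilt ψ R (w ξ) (X ξ, m ξ) ∂ℙ
      ≤ (∫⁻ ξ, ⨅ y, tilt ψ R y (X ξ, m ξ) ∂ℙ) + ENNReal.ofReal ε := by
    calc _ ≤ ∫⁻ ξ, (⨅ y, tilt ψ R y (X ξ, m ξ)) + ENNReal.ofReal ε ∂ℙ := by
          refine lintegral_mono_ae ?_
          filter_upwards [hy₀ae] with ξ hξ
          exact hsle _ (ENNReal.add_ne_top.2 ⟨hξ, ENNReal.ofReal_ne_top⟩)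
      _ = _ := by rw [lintegral_add_right _ measurable_const]; simp
  have hψle : ∫⁻ ξ, ψ (w ξ) (X ξ) ∂ℙ ≤ ∫⁻ ξ, tilt ψ R (w ξ) (X ξ, m ξ) ∂ℙ :=
    lintegral_mono fun ξ => le_self_add
  have hψfin : ∫⁻ ξ, ψ (w ξ) (X ξ) ∂ℙ ≠ ⊤ :=
    ne_top_of_le_ne_top (ENNReal.add_ne_top.2 ⟨hTfin, ENNReal.ofReal_ne_top⟩) (hψle.trans hle)
  have hwR := ae_norm_le_of_lintegral_ne_top hψ hX hR hw.aemeasurable hψfin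
  have hwm : MemLp w 2 ℙ := MemLp.of_bound hw.aestronglyMeasurable R hwR
  have h1 := hm (hwm.toLp w) _ ENNReal.toReal_nonneg (le_of_eq (by
    rw [ENNReal.ofReal_toReal hψfin]
    refine lintegral_congr_ae ?_
    filter_upwards [hwm.coeFn_toLp] with ξ e
    rw [e]))
  have h2 : inner ℝ m (hwm.toLp w) = ∫ ξ, inner ℝ (m ξ) (w ξ) ∂ℙ := by
    rw [L2.inner_def]
    refine integral_congr_ae ?_
    filter_upwards [hwm.coeFn_toLp] with ξ e
    rw [e]
  rw [lintegral_tilt hψ hX hmint hw.aestronglyMeasurable hwR] at hle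
  have h3 := ENNReal.toReal_mono (ENNReal.add_ne_top.2 ⟨hTfin, ENNReal.ofReal_ne_top⟩) hle
  rw [ENNReal.toReal_add hψfin ENNReal.ofReal_ne_top,
    ENNReal.toReal_add hTfin ENNReal.ofReal_ne_top, ENNReal.toReal_ofReal hε.le] at h3
  have h5 := le_max_left (∫ ξ, inner ℝ (m ξ) (w ξ) ∂ℙ + R * ∫ ξ, ‖m ξ‖ ∂ℙ) 0
  rw [ENNReal.toReal_ofReal'] at h3
  linarith

end Interchange

/-! ### The market cost as a lower semicontinuous convex integrand -/

open Classical in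
theorem lowerSemicontinuous_ite_top {X : Type*} [TopologicalSpace X] {S : Set X} (hS : IsClosed S)
    {f : X → ℝ≥0∞} (hf : Continuous f) :
    LowerSemicontinuous fun x => if x ∈ S then f x else ⊤ := by
  rw [lowerSemicontinuous_iff_isClosed_preimage]
  intro a
  rcases eq_or_ne a ⊤ with rfl | ha
  · simp
  · convert hS.inter ((isClosed_Iic (a := a)).preimage hf) using 1
    ext x
    by_cases hx : x ∈ S <;> simp [hx, ha]

theorem isCompact_euclideanBox {ι : Type*} [Fintype ι] (lo hi : ι → ℝ) :
    IsCompact {y : EuclideanSpace ℝ ι | ∀ k, lo k ≤ y k ∧ y k ≤ hi k} := by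
  have h : IsCompact (WithLp.toLp 2 '' Set.Icc lo hi : Set (EuclideanSpace ℝ ι)) :=
    isCompact_Icc.image (PiLp.continuous_toLp 2 _)
  convert h using 1
  ext y
  constructor
  · intro hy
    exact ⟨WithLp.ofLp y, ⟨fun k => (hy k).1, fun k => (hy k).2⟩, rfl⟩
  · rintro ⟨v, ⟨h1, h2⟩, rfl⟩ k
    exact ⟨h1 k, h2 k⟩

namespace Market

variable {N P : Type*} {L : Finset (N × N)} {Ξ : Type*}

/-- The scenario-independent part of the real-time constraints. -/
def realTimeBox (M : Market N P L Ξ) : Set (Decision P L) :=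
  {z | (∀ i : P, M.Xmin i ≤ z (Sum.inl i) ∧ z (Sum.inl i) ≤ M.Xmax i) ∧
    (∀ l : L, M.Fmin l ≤ z (Sum.inr l) ∧ z (Sum.inr l) ≤ M.Fmax l) ∧
    (fun l : L => z (Sum.inr l)) ∈ M.flowSet}

theorem mem_C2_iff (M : Market N P L Ξ) (ξ : Ξ) (z : Decision P L) :
    z ∈ M.C2 ξ ↔ z ∈ M.realTimeBox ∧
      ∀ i, -M.Xavail i ξ ≤ z (Sum.inl i) ∧ z (Sum.inl i) ≤ M.Xavail i ξ := by
  simp only [C2, realTimeBox, Set.mem_ofPred_eq, max_le_iff, le_min_iff]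
  constructor
  · rintro ⟨h1, h2, h3⟩
    exact ⟨⟨fun i => ⟨(h1 i).1.1, (h1 i).2.1⟩, h2, h3⟩, fun i => ⟨(h1 i).1.2, (h1 i).2.2⟩⟩
  · rintro ⟨⟨h1, h2, h3⟩, h4⟩
    exact ⟨fun i => ⟨⟨(h1 i).1, (h4 i).1⟩, ⟨(h1 i).2, (h4 i).2⟩⟩, h2, h3⟩

/-- The decision with the quantities of `z` and the flows of `z'`. -/
def splice (z z' : Decision P L) : Decision P L :=
  WithLp.toLp 2 (Sum.elim (fun i => z (Sum.inl i)) fun l => z' (Sum.inr l))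

/-- Freezing the quantities at those of one point of `C2 ξ` isolates the flow constraints. Convexity
and closedness thus pass from one scenario to the scenario-free set `realTimeBox`, although nothing
is assumed about `flowSet` itself. -/
theorem mem_realTimeBox_iff {M : Market N P L Ξ} {ξ : Ξ} {z : Decision P L} (hz : z ∈ M.C2 ξ)
    (z' : Decision P L) : z' ∈ M.realTimeBox ↔
      (∀ i : P, M.Xmin i ≤ z' (Sum.inl i) ∧ z' (Sum.inl i) ≤ M.Xmax i) ∧
        splice z z' ∈ M.C2 ξ :=
  ⟨fun h => ⟨h.1, hz.1, h.2⟩, fun h => ⟨h.1, h.2.2⟩⟩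

theorem convex_realTimeBox {M : Market N P L Ξ} {ξ : Ξ} (hne : (M.C2 ξ).Nonempty)
    (hc : Convex ℝ (M.C2 ξ)) : Convex ℝ M.realTimeBox := by
  obtain ⟨z, hz⟩ := hne
  intro z₁ h₁ z₂ h₂ a b ha hb hab
  rw [mem_realTimeBox_iff hz] at *
  refine ⟨fun i => ?_, ?_⟩
  · exact convex_Icc (𝕜 := ℝ) (M.Xmin i) (M.Xmax i) (h₁.1 i) (h₂.1 i) ha hb hab
  · convert hc h₁.2 h₂.2 ha hb hab using 1
    ext k
    rcases k with i | l
    · simp only [splice, Sum.elim_inl, PiLp.add_apply, PiLp.smul_apply, smul_eq_mul]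
      rw [← add_mul, hab, one_mul]
    · simp [splice]

theorem continuous_splice (z : Decision P L) : Continuous (splice z) := by
  refine (PiLp.continuous_toLp 2 _).comp (continuous_pi fun k => ?_)
  rcases k with i | l
  · exact continuous_const
  · simp only [Sum.elim_inr]
    fun_prop

section

variable [Fintype P]

theorem isCompact_realTimeBox {M : Market N P L Ξ} {ξ : Ξ} (hne : (M.C2 ξ).Nonempty)
    (hc : IsClosed (M.C2 ξ)) : IsCompact M.realTimeBox := by
  obtain ⟨z, hz⟩ := hne
  refine (isCompact_euclideanBox (Sum.elim M.Xmin M.Fmin)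
    (Sum.elim M.Xmax M.Fmax)).of_isClosed_subset ?_ ?_
  · have : M.realTimeBox = (⋂ i : P, {z' | M.Xmin i ≤ z' (Sum.inl i) ∧ z' (Sum.inl i) ≤ M.Xmax i})
        ∩ splice z ⁻¹' M.C2 ξ := by
      ext z'
      rw [mem_realTimeBox_iff hz]
      simp
    rw [this]
    refine (isClosed_iInter fun i => ?_).inter (hc.preimage (continuous_splice z))
    have hi : Continuous fun z' : Decision P L => z' (Sum.inl i) := by fun_prop
    exact (isClosed_le continuous_const hi).inter (isClosed_le hi continuous_const)
  · rintro z' ⟨h1, h2, -⟩ (i | l)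
    · exact h1 i
    · exact h2 l

theorem isCompact_C1 {M : Market N P L Ξ} (hc : IsClosed M.C1) : IsCompact M.C1 := by
  refine (isCompact_euclideanBox (Sum.elim M.xmin M.fmin)
    (Sum.elim M.xmax M.fmax)).of_isClosed_subset hc ?_
  rintro y ⟨h1, h2, -⟩ (i | l)
  · exact h1 i
  · exact h2 l

@[fun_prop]
theorem continuous_f1 (M : Market N P L Ξ) : Continuous M.f1 := by
  unfold f1
  fun_prop

@[fun_prop]
theorem continuous_f2 (M : Market N P L Ξ) :
    Continuous fun p : Decision P L × Decision P L => M.f2 p.1 p.2 := by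
  unfold f2
  fun_prop

variable [DecidableEq N]

theorem continuous_g1 (M : Market N P L Ξ) (i : N) : Continuous fun y => M.g1 y i := by
  unfold g1 netFlow
  fun_prop

theorem continuous_g2 (M : Market N P L Ξ) (i : N) :
    Continuous fun p : Decision P L × Decision P L => M.g2 p.1 p.2 i := by
  unfold g2 netFlow
  fun_prop

theorem g1_combo (M : Market N P L Ξ) (y₁ y₂ : Decision P L) (a b : ℝ) (i : N) :
    M.g1 (a • y₁ + b • y₂) i = a * M.g1 y₁ i + b * M.g1 y₂ i := by
  simp only [g1, netFlow, PiLp.add_apply, PiLp.smul_apply, smul_eq_mul, Finset.sum_add_distrib,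
    ← Finset.mul_sum]
  ring

theorem g2_combo (M : Market N P L Ξ) (y₁ y₂ z₁ z₂ : Decision P L) (a b : ℝ) (i : N) :
    M.g2 (a • y₁ + b • y₂) (a • z₁ + b • z₂) i = a * M.g2 y₁ z₁ i + b * M.g2 y₂ z₂ i := by
  simp only [g2, netFlow, PiLp.add_apply, PiLp.smul_apply, smul_eq_mul, Finset.sum_add_distrib,
    Finset.sum_sub_distrib, ← Finset.mul_sum]
  ring

/-- The triples of a day-ahead decision, available quantities and a real-time decision from
`realTimeBox` that satisfy all remaining constraints. -/
def jointFeasible (M : Market N P L Ξ) : Set ((Decision P L × (P → ℝ)) × Decision P L) :=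
  {p | (p.1.1 ∈ M.C1 ∧ ∀ i, M.g1 p.1.1 i = 0) ∧ (∀ i, M.g2 p.1.1 p.2 i = 0) ∧
    ∀ j, -p.1.2 j ≤ p.2 (Sum.inl j) ∧ p.2 (Sum.inl j) ≤ p.1.2 j}

theorem isClosed_jointFeasible {M : Market N P L Ξ} (hc : IsClosed M.C1) :
    IsClosed M.jointFeasible := by
  have h : M.jointFeasible = ((fun p => p.1.1) ⁻¹' M.C1 ∩ ⋂ i, {p | M.g1 p.1.1 i = 0}) ∩
      ((⋂ i, {p | M.g2 p.1.1 p.2 i = 0}) ∩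
        ⋂ j, ({p | -p.1.2 j ≤ p.2 (Sum.inl j)} ∩ {p | p.2 (Sum.inl j) ≤ p.1.2 j})) := by
    ext p
    simp [jointFeasible]
  rw [h]
  refine (((hc.preimage (by fun_prop)).inter (isClosed_iInter fun i => ?_))).inter
    ((isClosed_iInter fun i => ?_).inter (isClosed_iInter fun j => ?_))
  · exact isClosed_eq ((M.continuous_g1 i).comp (by fun_prop)) continuous_const
  · exact isClosed_eq ((M.continuous_g2 i).comp
      (f := fun p : (Decision P L × (P → ℝ)) × Decision P L => (p.1.1, p.2)) (by fun_prop))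
      continuous_const
  · exact (isClosed_le (by fun_prop) (by fun_prop)).inter (isClosed_le (by fun_prop) (by fun_prop))

open Classical in
/-- Total cost shifted by `B`, and `∞` outside the joint constraints. -/
def shiftedCost (M : Market N P L Ξ) (B : ℝ) (p : Decision P L × (P → ℝ)) (z : Decision P L) :
    ℝ≥0∞ :=
  if (p, z) ∈ M.jointFeasible then ENNReal.ofReal (M.f1 p.1 + M.f2 p.1 z + B) else ⊤

theorem lowerSemicontinuous_shiftedCost {M : Market N P L Ξ} (hc : IsClosed M.C1) (B : ℝ) :
    LowerSemicontinuous fun p : (Decision P L × (P → ℝ)) × Decision P L =>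
      M.shiftedCost B p.1 p.2 := by
  refine lowerSemicontinuous_ite_top (isClosed_jointFeasible hc)
    (ENNReal.continuous_ofReal.comp ?_)
  have h1 : Continuous fun p : (Decision P L × (P → ℝ)) × Decision P L => M.f1 p.1.1 :=
    M.continuous_f1.comp (by fun_prop)
  have h2 : Continuous fun p : (Decision P L × (P → ℝ)) × Decision P L => M.f2 p.1.1 p.2 :=
    M.continuous_f2.comp
      (f := fun p : (Decision P L × (P → ℝ)) × Decision P L => (p.1.1, p.2)) (by fun_prop)
  exact (h1.add h2).add continuous_const

/-- The extended-valued cost `phi` shifted by `B`, as a function of the decision and of the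
available quantities. -/
def shiftedPhi (M : Market N P L Ξ) (B : ℝ) (y : Decision P L) (w : P → ℝ) : ℝ≥0∞ :=
  ⨅ z ∈ M.realTimeBox, M.shiftedCost B (y, w) z

theorem lowerSemicontinuous_shiftedPhi {M : Market N P L Ξ} (hc : IsClosed M.C1)
    (hK : IsCompact M.realTimeBox) (B : ℝ) :
    LowerSemicontinuous fun p : Decision P L × (P → ℝ) => M.shiftedPhi B p.1 p.2 :=
  lowerSemicontinuous_biInf_of_isCompact (lowerSemicontinuous_shiftedCost hc B) hK

theorem shiftedPhi_eq_top {M : Market N P L Ξ} {y : Decision P L} (hy : y ∉ M.C1) (B : ℝ)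
    (w : P → ℝ) : M.shiftedPhi B y w = ⊤ := by
  simp [shiftedPhi, shiftedCost, jointFeasible, hy]

theorem exists_mem_jointFeasible {M : Market N P L Ξ} (hc : IsClosed M.C1)
    (hK : IsCompact M.realTimeBox) {B : ℝ} {y : Decision P L} {w : P → ℝ}
    (h : M.shiftedPhi B y w ≠ ⊤) : ∃ z ∈ M.realTimeBox, ((y, w), z) ∈ M.jointFeasible ∧
      M.shiftedPhi B y w = ENNReal.ofReal (M.f1 y + M.f2 y z + B) := by
  have hne : M.realTimeBox.Nonempty := by
    by_contra hne
    rw [Set.not_nonempty_iff_eq_empty] at hne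
    simp [shiftedPhi, hne] at h
  have hl : LowerSemicontinuous (M.shiftedCost B (y, w)) :=
    (lowerSemicontinuous_shiftedCost hc B).comp (g := fun z : Decision P L => ((y, w), z))
      (by fun_prop)
  obtain ⟨z, hz, hmin⟩ := (hl.lowerSemicontinuousOn _).exists_isMinOn hne hK
  have heq : M.shiftedPhi B y w = M.shiftedCost B (y, w) z :=
    le_antisymm (iInf₂_le z hz) (le_iInf₂ fun z' hz' => hmin hz')
  by_cases hf : ((y, w), z) ∈ M.jointFeasible
  · exact ⟨z, hz, hf, by rw [heq, shiftedCost, if_pos hf]⟩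
  · rw [heq, shiftedCost, if_neg hf] at h
    exact absurd rfl h

theorem combo_mem_jointFeasible {M : Market N P L Ξ} (hc : Convex ℝ M.C1) {w : P → ℝ}
    {y₁ y₂ z₁ z₂ : Decision P L} (h₁ : ((y₁, w), z₁) ∈ M.jointFeasible)
    (h₂ : ((y₂, w), z₂) ∈ M.jointFeasible) {a b : ℝ} (ha : 0 ≤ a) (hb : 0 ≤ b)
    (hab : a + b = 1) :
    ((a • y₁ + b • y₂, w), a • z₁ + b • z₂) ∈ M.jointFeasible := by
  refine ⟨⟨hc h₁.1.1 h₂.1.1 ha hb hab, fun i => ?_⟩, fun i => ?_, fun j => ?_⟩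
  · have e₁ := h₁.1.2 i
    have e₂ := h₂.1.2 i
    dsimp only at e₁ e₂ ⊢
    rw [g1_combo, e₁, e₂, mul_zero, mul_zero, add_zero]
  · have e₁ := h₁.2.1 i
    have e₂ := h₂.2.1 i
    dsimp only at e₁ e₂ ⊢
    rw [g2_combo, e₁, e₂, mul_zero, mul_zero, add_zero]
  · exact convex_Icc (𝕜 := ℝ) (-w j) (w j) (h₁.2.2 j) (h₂.2.2 j) ha hb hab

theorem shiftedPhi_convex [MeasurableSpace Ξ] {ℙ : Measure Ξ} {M : Market N P L Ξ}
    (hM : M.ConvexityAssumption ℙ) (hK : IsCompact M.realTimeBox)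
    (hKc : Convex ℝ M.realTimeBox) (B : ℝ) (w : P → ℝ) (y₁ y₂ : Decision P L) (a b : ℝ)
    (ha : 0 ≤ a) (hb : 0 ≤ b) (hab : a + b = 1) :
    M.shiftedPhi B (a • y₁ + b • y₂) w
      ≤ ENNReal.ofReal a * M.shiftedPhi B y₁ w + ENNReal.ofReal b * M.shiftedPhi B y₂ w := by
  -- Zero weights are treated apart because `0 * ⊤ = 0` in `ℝ≥0∞`: an infinite value on the right
  -- would be lost.
  rcases ha.eq_or_lt with rfl | ha'
  · obtain rfl : b = 1 := by linarith
    simp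
  rcases hb.eq_or_lt with rfl | hb'
  · obtain rfl : a = 1 := by linarith
    simp
  by_cases hy₁ : M.shiftedPhi B y₁ w = ⊤
  · rw [hy₁, ENNReal.mul_top (by simpa using ha'), top_add]
    exact le_top
  by_cases hy₂ : M.shiftedPhi B y₂ w = ⊤
  · rw [hy₂, ENNReal.mul_top (by simpa using hb'), add_top]
    exact le_top
  obtain ⟨z₁, hz₁, hf₁, e₁⟩ := exists_mem_jointFeasible hM.closed_C1 hK hy₁
  obtain ⟨z₂, hz₂, hf₂, e₂⟩ := exists_mem_jointFeasible hM.closed_C1 hK hy₂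
  have hf := combo_mem_jointFeasible hM.convex_C1 hf₁ hf₂ ha hb hab
  refine (iInf₂_le _ (hKc hz₁ hz₂ ha hb hab)).trans ?_
  rw [shiftedCost, if_pos hf, e₁, e₂, ← ENNReal.ofReal_mul ha, ← ENNReal.ofReal_mul hb]
  refine le_trans (ENNReal.ofReal_le_ofReal ?_) ENNReal.ofReal_add_le
  have c₁ := hM.convex_f1.2 (Set.mem_univ y₁) (Set.mem_univ y₂) ha hb hab
  have c₂ := hM.convex_f2.2 (Set.mem_univ (y₁, z₁)) (Set.mem_univ (y₂, z₂)) ha hb hab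
  simp only [smul_eq_mul, Prod.fst_add, Prod.snd_add, Prod.smul_fst, Prod.smul_snd] at c₁ c₂
  have hB : B = a * B + b * B := by rw [← add_mul, hab, one_mul]
  dsimp only
  linarith

theorem phi_eq_shiftedPhi_sub {M : Market N P L Ξ} {B : ℝ}
    (hB : ∀ y ∈ M.C1, ∀ z ∈ M.realTimeBox, 0 ≤ M.f1 y + M.f2 y z + B) (y : Decision P L) (ξ : Ξ) :
    M.phi y ξ = (M.shiftedPhi B y (fun i => M.Xavail i ξ) : EReal) - (B : ℝ) := by
  unfold phi
  split_ifs with hy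
  swap
  · have : M.shiftedPhi B y (fun i => M.Xavail i ξ) = ⊤ := by
      simp [shiftedPhi, shiftedCost, jointFeasible, hy]
    rw [this]
    rfl
  apply le_antisymm
  · have hle : (((M.f1 y : ℝ) : EReal) + M.H y ξ + (B : ℝ)).toENNReal
        ≤ M.shiftedPhi B y (fun i => M.Xavail i ξ) := by
      refine le_iInf₂ fun z hz => ?_
      unfold shiftedCost
      split_ifs with hf
      · rw [← EReal.real_coe_toENNReal, EReal.coe_add, EReal.coe_add]
        refine EReal.toENNReal_le_toENNReal ?_
        have hH : M.H y ξ ≤ (M.f2 y z : ℝ) :=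
          iInf₂_le z ⟨(M.mem_C2_iff ξ z).2 ⟨hz, hf.2.2⟩, hf.2.1⟩
        gcongr
      · exact le_top
    have h2 : ((M.f1 y : ℝ) : EReal) + M.H y ξ + (B : ℝ)
        ≤ (M.shiftedPhi B y (fun i => M.Xavail i ξ) : EReal) := by
      refine (le_max_right 0 _).trans ?_
      rw [← EReal.coe_toENNReal_eq_max]
      exact_mod_cast hle
    rw [EReal.le_sub_iff_add_le (by simp) (by simp)]
    exact h2
  · have h1 : (M.shiftedPhi B y (fun i => M.Xavail i ξ) : EReal) - (B : ℝ) - (M.f1 y : ℝ)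
        ≤ M.H y ξ := by
      refine le_iInf₂ fun z hz => ?_
      rw [Set.mem_ofPred_eq, mem_C2_iff] at hz
      have hf : ((y, fun i => M.Xavail i ξ), z) ∈ M.jointFeasible := ⟨hy, hz.2, hz.1.2⟩
      have h2 : M.shiftedPhi B y (fun i => M.Xavail i ξ)
          ≤ ENNReal.ofReal (M.f1 y + M.f2 y z + B) := by
        refine (iInf₂_le z hz.1.1).trans (le_of_eq ?_)
        rw [shiftedCost, if_pos hf]
      rw [EReal.sub_le_iff_le_add (by simp) (by simp), EReal.sub_le_iff_le_add (by simp) (by simp)]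
      have h3 : (M.shiftedPhi B y (fun i => M.Xavail i ξ) : EReal)
          ≤ ((ENNReal.ofReal (M.f1 y + M.f2 y z + B) : ℝ≥0∞) : EReal) := by exact_mod_cast h2
      refine h3.trans (le_of_eq ?_)
      -- Here the choice of `B` matters: the shifted cost is nonnegative, so `ENNReal.ofReal` does
      -- not truncate it.
      rw [EReal.coe_ennreal_ofReal, max_eq_left (hB y hy.1 z hz.1.1)]
      norm_cast
      ring
    rw [add_comm]
    rwa [EReal.sub_le_iff_le_add (by simp) (by simp)] at h1

/-- All that the duality argument needs from the market. One scenario with convex, closed, nonempty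
`C2 ξ` suffices, since the rest of the dependence on `ξ` is through linear bounds by the available
quantities. `B` bounds the total cost on the compact set `C1 × realTimeBox`, and `R` bounds the norm
on `C1`. -/
theorem exists_integrand [MeasurableSpace Ξ] {ℙ : Measure Ξ} [IsProbabilityMeasure ℙ]
    {M : Market N P L Ξ} (hM : M.ConvexityAssumption ℙ) :
    ∃ (ψ : Decision P L → (P → ℝ) → ℝ≥0∞) (B R : ℝ),
      (LowerSemicontinuous fun p : Decision P L × (P → ℝ) => ψ p.1 p.2) ∧
      (∀ w y₁ y₂, ∀ a b : ℝ, 0 ≤ a → 0 ≤ b → a + b = 1 →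
        ψ (a • y₁ + b • y₂) w ≤ ENNReal.ofReal a * ψ y₁ w + ENNReal.ofReal b * ψ y₂ w) ∧
      (∀ y w, R < ‖y‖ → ψ y w = ⊤) ∧
      ∀ y ξ, M.phi y ξ = (ψ y (fun i => M.Xavail i ξ) : EReal) - (B : ℝ) := by
  obtain ⟨ξ, ⟨hcvx, hcl⟩, hne⟩ := ((hM.convex_C2.and hM.closed_C2).and hM.nonempty_C2).exists
  have hK := isCompact_realTimeBox hne hcl
  obtain ⟨R, hR⟩ := (isCompact_C1 hM.closed_C1).isBounded.exists_norm_le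
  have hcont : Continuous fun p : Decision P L × Decision P L => M.f1 p.1 + M.f2 p.1 p.2 :=
    (M.continuous_f1.comp continuous_fst).add M.continuous_f2
  obtain ⟨B, hB⟩ := ((isCompact_C1 hM.closed_C1).prod hK).exists_bound_of_continuousOn
    hcont.continuousOn
  refine ⟨M.shiftedPhi B, B, R, lowerSemicontinuous_shiftedPhi hM.closed_C1 hK B,
    shiftedPhi_convex hM hK (convex_realTimeBox hne hcvx) B,
    fun y w hy => shiftedPhi_eq_top (fun h => (hR y h).not_gt hy) B w,
    phi_eq_shiftedPhi_sub fun y hy z hz => ?_⟩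
  have := (abs_le.1 (hB (y, z) ⟨hy, hz⟩)).1
  dsimp only at this
  linarith

end

end Market

/-! ### Extended-real expectations -/

section Expectation

variable {Ξ : Type*} [MeasurableSpace Ξ] {ℙ : Measure Ξ}

theorem expectE_mono {Z Z' : Ξ → EReal} (h : ∀ᵐ ξ ∂ℙ, Z ξ ≤ Z' ξ) :
    expectE ℙ Z ≤ expectE ℙ Z' := by
  have hpos : ∫⁻ ξ, (Z ξ).toENNReal ∂ℙ ≤ ∫⁻ ξ, (Z' ξ).toENNReal ∂ℙ :=
    lintegral_mono_ae (h.mono fun ξ hξ => EReal.toENNReal_le_toENNReal hξ)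
  have hneg : ∫⁻ ξ, (-Z' ξ).toENNReal ∂ℙ ≤ ∫⁻ ξ, (-Z ξ).toENNReal ∂ℙ :=
    lintegral_mono_ae (h.mono fun ξ hξ =>
      EReal.toENNReal_le_toENNReal (EReal.neg_le_neg_iff.2 hξ))
  unfold expectE
  split_ifs with h1 h2 h2
  · exact le_rfl
  · rw [h1, top_le_iff] at hpos
    exact absurd hpos h2
  · exact le_top
  · exact EReal.sub_le_sub (by exact_mod_cast hpos) (by exact_mod_cast hneg)

theorem expectE_of_ae_eq_coe {Z : Ξ → EReal} {h : Ξ → ℝ} (hh : Integrable h ℙ)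
    (hZ : ∀ᵐ ξ ∂ℙ, Z ξ = (h ξ : ℝ)) : expectE ℙ Z = ((∫ ξ, h ξ ∂ℙ : ℝ) : EReal) := by
  have h1 : ∫⁻ ξ, (Z ξ).toENNReal ∂ℙ = ∫⁻ ξ, ENNReal.ofReal (h ξ) ∂ℙ :=
    lintegral_congr_ae (hZ.mono fun ξ hξ => by simp only [hξ, EReal.real_coe_toENNReal])
  have h2 : ∫⁻ ξ, (-Z ξ).toENNReal ∂ℙ = ∫⁻ ξ, ENNReal.ofReal (-h ξ) ∂ℙ :=
    lintegral_congr_ae (hZ.mono fun ξ hξ => by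
      simp only [hξ, ← EReal.coe_neg, EReal.real_coe_toENNReal])
  have f1 : ∫⁻ ξ, ENNReal.ofReal (h ξ) ∂ℙ ≠ ⊤ := hh.lintegral_lt_top.ne
  have f2 : ∫⁻ ξ, ENNReal.ofReal (-h ξ) ∂ℙ ≠ ⊤ := hh.neg.lintegral_lt_top.ne
  rw [expectE, h1, h2, if_neg f1, integral_eq_lintegral_pos_part_sub_lintegral_neg_part hh,
    EReal.coe_sub, EReal.coe_ennreal_toReal f1, EReal.coe_ennreal_toReal f2]

theorem expectE_coe_add {p : Ξ → ℝ≥0∞} {g : Ξ → ℝ} (hp : AEMeasurable p ℙ)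
    (hg : Integrable g ℙ) : expectE ℙ (fun ξ => (p ξ : EReal) + (g ξ : ℝ))
      = ((∫⁻ ξ, p ξ ∂ℙ : ℝ≥0∞) : EReal) + ((∫ ξ, g ξ ∂ℙ : ℝ) : EReal) := by
  by_cases hfin : ∫⁻ ξ, p ξ ∂ℙ = ⊤
  -- From `p ≤ (p + g)₊ + (-g)₊` with `g` integrable, the positive part of `p + g` has infinite
  -- integral too.
  · have hle : ∫⁻ ξ, p ξ ∂ℙ ≤ ∫⁻ ξ, ((p ξ : EReal) + (g ξ : ℝ)).toENNReal ∂ℙ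
        + ∫⁻ ξ, ENNReal.ofReal (-g ξ) ∂ℙ := by
      have hneg : AEMeasurable (fun ξ => ENNReal.ofReal (-g ξ)) ℙ :=
        hg.1.aemeasurable.neg.ennreal_ofReal
      rw [← lintegral_add_right' _ hneg]
      refine lintegral_mono fun ξ => ?_
      dsimp only
      have h1 := EReal.toENNReal_add_le (x := (p ξ : EReal) + (g ξ : ℝ)) (y := ((-g ξ : ℝ) : EReal))
      rw [add_assoc, ← EReal.coe_add, add_neg_cancel, EReal.coe_zero, add_zero,
        EReal.toENNReal_coe] at h1
      exact h1
    have htop : ∫⁻ ξ, ((p ξ : EReal) + (g ξ : ℝ)).toENNReal ∂ℙ = ⊤ := by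
      rw [hfin, top_le_iff, ENNReal.add_eq_top] at hle
      exact hle.resolve_right hg.neg.lintegral_lt_top.ne
    rw [expectE, if_pos htop, hfin, EReal.coe_ennreal_top, EReal.top_add_coe]
  · have hpi : Integrable (fun ξ => (p ξ).toReal) ℙ := integrable_toReal_of_lintegral_ne_top hp hfin
    rw [expectE_of_ae_eq_coe (hpi.add hg)]
    · simp only [Pi.add_apply]
      rw [integral_add hpi hg, integral_toReal hp (ae_lt_top' hp hfin), EReal.coe_add,
        EReal.coe_ennreal_toReal hfin]
    · filter_upwards [ae_lt_top' hp hfin] with ξ hξ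
      rw [Pi.add_apply, EReal.coe_add, EReal.coe_ennreal_toReal hξ.ne]

end Expectation

/-! ### The stochastic Lagrangian through the tilted integrand -/

section Tilt

set_option linter.unusedSectionVars false

variable {Ξ E W : Type*} [MeasurableSpace Ξ] {ℙ : Measure Ξ} [IsProbabilityMeasure ℙ]
  [NormedAddCommGroup E] [InnerProductSpace ℝ E] [FiniteDimensional ℝ E] [MeasurableSpace E]
  [BorelSpace E] [TopologicalSpace W] [SecondCountableTopology W] [MeasurableSpace W]
  [BorelSpace W] {ψ : E → W → ℝ≥0∞} {X : Ξ → W} {R : ℝ}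

theorem aemeasurable_iInf_tilt (hψ : LowerSemicontinuous fun p : E × W => ψ p.1 p.2)
    (hX : Measurable X) (hR : ∀ y w, R < ‖y‖ → ψ y w = ⊤) {n : Ξ → E} (hn : Integrable n ℙ) :
    AEMeasurable (fun ξ => ⨅ y, tilt ψ R y (X ξ, n ξ)) ℙ := by
  have h1 : LowerSemicontinuous fun p : (W × E) × E => tilt ψ R p.2 p.1 :=
    (lowerSemicontinuous_tilt hψ).comp (g := fun p : (W × E) × E => (p.2, p.1)) (by fun_prop)
  have h2 := lowerSemicontinuous_biInf_of_isCompact (F := fun p y => tilt ψ R y p) h1 (isCompact_closedBall (0 : E) R)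
  -- The tilt is infinite off the ball, so the infimum may be taken over a compact set.
  have h3 : ∀ p : W × E, ⨅ y ∈ Metric.closedBall (0 : E) R, tilt ψ R y p = ⨅ y, tilt ψ R y p := by
    refine fun p => le_antisymm (le_iInf fun y => ?_) (le_iInf₂ fun y _ => iInf_le _ y)
    by_cases hy : R < ‖y‖
    · rw [tilt_eq_top hR y p hy]
      exact le_top
    · exact iInf₂_le y (mem_closedBall_zero_iff.2 (not_lt.1 hy))
  simp only [h3] at h2
  exact h2.measurable.comp_aemeasurable (hX.aemeasurable.prodMk hn.1.aemeasurable)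

theorem exists_tilt_eq_iInf (hψ : LowerSemicontinuous fun p : E × W => ψ p.1 p.2)
    (hR : ∀ y w, R < ‖y‖ → ψ y w = ⊤) {p : W × E} (hp : ⨅ y, tilt ψ R y p ≠ ⊤) :
    ∃ y, tilt ψ R y p = ⨅ y, tilt ψ R y p := by
  have hball : ∀ {y}, tilt ψ R y p ≠ ⊤ → y ∈ Metric.closedBall (0 : E) R := by
    intro y h
    rw [mem_closedBall_zero_iff]
    by_contra! hlt
    exact h (tilt_eq_top hR y p hlt)
  obtain ⟨y₀, hy₀⟩ : ∃ y, tilt ψ R y p ≠ ⊤ := by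
    by_contra! h
    exact hp (by simp [h])
  have h1 : LowerSemicontinuous fun y => tilt ψ R y p :=
    (lowerSemicontinuous_tilt hψ).comp (g := fun y : E => (y, p)) (by fun_prop)
  obtain ⟨y, -, hy⟩ := (h1.lowerSemicontinuousOn _).exists_isMinOn ⟨y₀, hball hy₀⟩
    (isCompact_closedBall (0 : E) R)
  refine ⟨y, le_antisymm (le_iInf fun z => ?_) (iInf_le _ y)⟩
  by_cases hz : tilt ψ R z p = ⊤
  · rw [hz]
    exact le_top
  · exact hy (hball hz)

theorem iSup_inner_sub_eq (hψ : LowerSemicontinuous fun p : E × W => ψ p.1 p.2)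
    (hR : ∀ y w, R < ‖y‖ → ψ y w = ⊤) {w : W} {n : E} (B : ℝ)
    (hp : ⨅ y, tilt ψ R y (w, n) ≠ ⊤) :
    ⨆ y, ((inner ℝ (-n) y : ℝ) : EReal) - ((ψ y w : EReal) - (B : ℝ))
      = ((B + R * ‖n‖ - (⨅ y, tilt ψ R y (w, n)).toReal : ℝ) : EReal) := by
  have hval : ∀ y, ψ y w ≠ ⊤ → ((inner ℝ (-n) y : ℝ) : EReal) - ((ψ y w : EReal) - (B : ℝ))
      = ((B + R * ‖n‖ - (tilt ψ R y (w, n)).toReal : ℝ) : EReal) := by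
    intro y hy
    have hyR : ‖y‖ ≤ R := by
      by_contra! hlt
      exact hy (hR y w hlt)
    have h1 := abs_le.1 (abs_real_inner_le_norm n y)
    have h2 : ‖n‖ * ‖y‖ ≤ ‖n‖ * R := by gcongr
    have h0 : 0 ≤ inner ℝ n y + R * ‖n‖ := by linarith
    rw [tilt, ENNReal.toReal_add hy ENNReal.ofReal_ne_top, ENNReal.toReal_ofReal h0,
      ← EReal.coe_ennreal_toReal hy, ← EReal.coe_sub, ← EReal.coe_sub, inner_neg_left]
    congr 1
    ring
  apply le_antisymm
  · refine iSup_le fun y => ?_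
    by_cases hy : ψ y w = ⊤
    · rw [hy]
      simp
    · rw [hval y hy, EReal.coe_le_coe_iff]
      have := ENNReal.toReal_mono (ENNReal.add_ne_top.2 ⟨hy, ENNReal.ofReal_ne_top⟩ :
        tilt ψ R y (w, n) ≠ ⊤) (iInf_le (fun y => tilt ψ R y (w, n)) y)
      change _ ≤ (tilt ψ R y (w, n)).toReal at this
      linarith
  · obtain ⟨y, hy⟩ := exists_tilt_eq_iInf hψ hR hp
    have hyfin : ψ y w ≠ ⊤ := by
      intro h
      rw [← hy, tilt, h, top_add] at hp
      exact hp rfl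
    rw [← hy, ← hval y hyfin]
    exact le_iSup (fun y => ((inner ℝ (-n) y : ℝ) : EReal) - ((ψ y w : EReal) - (B : ℝ))) y

end Tilt

/-! ### Weak and strong duality for the market -/

namespace Market

set_option linter.unusedSectionVars false

variable {N P Ξ : Type*} [DecidableEq N] [Fintype P] {L : Finset (N × N)} [MeasurableSpace Ξ]
  {ℙ : Measure Ξ} [IsProbabilityMeasure ℙ] {M : Market N P L Ξ}
  {ψ : Decision P L → (P → ℝ) → ℝ≥0∞} {B R : ℝ}

theorem measurable_avail (hM : M.ConvexityAssumption ℙ) :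
    Measurable fun ξ i => M.Xavail i ξ :=
  measurable_pi_lambda _ hM.measurable_avail

theorem integrable_mean_sub {μ : Ξ → Decision P L} (hμ : MemLp μ 1 ℙ) :
    Integrable (fun ξ => (∫ ξ', μ ξ' ∂ℙ) - μ ξ) ℙ :=
  (integrable_const _).sub (memLp_one_iff_integrable.1 hμ)

theorem stochLagrangian_ae_eq (hM : M.ConvexityAssumption ℙ)
    (hψ : LowerSemicontinuous fun p : Decision P L × (P → ℝ) => ψ p.1 p.2)
    (hR : ∀ y w, R < ‖y‖ → ψ y w = ⊤)
    (hphi : ∀ y ξ, M.phi y ξ = (ψ y (fun i => M.Xavail i ξ) : EReal) - (B : ℝ))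
    {c : Decision P L} (hc : ∫⁻ ξ, ψ c (fun i => M.Xavail i ξ) ∂ℙ ≠ ⊤) {μ : Ξ → Decision P L}
    (hμ : MemLp μ 1 ℙ) : ∀ᵐ ξ ∂ℙ, M.stochLagrangian ℙ μ ξ
      = ((B + R * ‖(∫ ξ', μ ξ' ∂ℙ) - μ ξ‖ - (⨅ y, tilt ψ R y
        (fun i => M.Xavail i ξ, (∫ ξ', μ ξ' ∂ℙ) - μ ξ)).toReal : ℝ) : EReal) := by
  have hn := integrable_mean_sub hμ
  have hX := measurable_avail hM
  filter_upwards [ae_lt_top' (aemeasurable_iInf_tilt hψ hX hR hn)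
    (lintegral_iInf_tilt_ne_top hψ hX hR hc hn)] with ξ hξ
  rw [← iSup_inner_sub_eq hψ hR B hξ.ne, neg_sub]
  simp only [stochLagrangian, hphi]

/-- `expectE` is not odd in general, owing to the convention `∞ - ∞ = ∞`. Here the Lagrangian is
a.e. equal to an integrable real function, so the sign passes through. -/
theorem expectE_stochLagrangian (hM : M.ConvexityAssumption ℙ)
    (hψ : LowerSemicontinuous fun p : Decision P L × (P → ℝ) => ψ p.1 p.2)
    (hR : ∀ y w, R < ‖y‖ → ψ y w = ⊤)
    (hphi : ∀ y ξ, M.phi y ξ = (ψ y (fun i => M.Xavail i ξ) : EReal) - (B : ℝ))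
    {c : Decision P L} (hc : ∫⁻ ξ, ψ c (fun i => M.Xavail i ξ) ∂ℙ ≠ ⊤) {μ : Ξ → Decision P L}
    (hμ : MemLp μ 1 ℙ) :
    expectE ℙ (M.stochLagrangian ℙ μ) = ((B + R * ∫ ξ, ‖(∫ ξ', μ ξ' ∂ℙ) - μ ξ‖ ∂ℙ
      - (∫⁻ ξ, ⨅ y, tilt ψ R y
        (fun i => M.Xavail i ξ, (∫ ξ', μ ξ' ∂ℙ) - μ ξ) ∂ℙ).toReal : ℝ) : EReal) ∧
    expectE ℙ (fun ξ => -M.stochLagrangian ℙ μ ξ) = -expectE ℙ (M.stochLagrangian ℙ μ) := by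
  have hn := integrable_mean_sub hμ
  have hX := measurable_avail hM
  have hm := aemeasurable_iInf_tilt hψ hX hR hn
  have hfin := lintegral_iInf_tilt_ne_top hψ hX hR hc hn
  have hi1 := integrable_toReal_of_lintegral_ne_top hm hfin
  have hi2 : Integrable (fun ξ => B + R * ‖(∫ ξ', μ ξ' ∂ℙ) - μ ξ‖) ℙ :=
    (integrable_const B).add (hn.norm.const_mul R)
  have hae := stochLagrangian_ae_eq hM hψ hR hphi hc hμ
  have hE := expectE_of_ae_eq_coe (hi2.sub hi1) hae
  constructor
  · rw [hE]
    simp only [Pi.sub_apply]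
    rw [integral_sub hi2 hi1, integral_add (integrable_const B) (hn.norm.const_mul R),
      integral_const_mul, integral_toReal hm (ae_lt_top' hm hfin)]
    simp
  · rw [hE, expectE_of_ae_eq_coe (hi2.sub hi1).neg, ← EReal.coe_neg, ← integral_neg]
    · rfl
    · filter_upwards [hae] with ξ hξ
      rw [hξ]
      rfl

/-- The pairing has opposite signs in `𝕃` and in the dual objective, hence `-μ`. The bound is
pointwise in `ξ`. -/
theorem neg_expectE_stochLagrangian_le_dualObjective (hM : M.ConvexityAssumption ℙ)
    (hψ : LowerSemicontinuous fun p : Decision P L × (P → ℝ) => ψ p.1 p.2)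
    (hR : ∀ y w, R < ‖y‖ → ψ y w = ⊤)
    (hphi : ∀ y ξ, M.phi y ξ = (ψ y (fun i => M.Xavail i ξ) : EReal) - (B : ℝ))
    {c : Decision P L} (hc : ∫⁻ ξ, ψ c (fun i => M.Xavail i ξ) ∂ℙ ≠ ⊤) {μ : Ξ → Decision P L}
    (hμ : MemLp μ 1 ℙ) :
    -expectE ℙ (M.stochLagrangian ℙ μ) ≤ M.dualObjective ℙ (-μ) := by
  rw [← (expectE_stochLagrangian hM hψ hR hphi hc hμ).2]
  refine le_iInf₂ fun y _ => expectE_mono (ae_of_all _ fun ξ => ?_)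
  have h1 : ((inner ℝ (μ ξ - ∫ ξ', μ ξ' ∂ℙ) (y ξ) : ℝ) : EReal) - M.phi (y ξ) ξ
      ≤ M.stochLagrangian ℙ μ ξ :=
    le_iSup (fun y => ((inner ℝ (μ ξ - ∫ ξ', μ ξ' ∂ℙ) y : ℝ) : EReal) - M.phi y ξ) (y ξ)
  refine (EReal.neg_le_neg_iff.2 h1).trans (le_of_eq ?_)
  have h2 : (-μ) ξ - ∫ ξ', (-μ) ξ' ∂ℙ = -(μ ξ - ∫ ξ', μ ξ' ∂ℙ) := by
    simp only [Pi.neg_apply, integral_neg]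
    abel
  rw [h2, inner_neg_left, EReal.neg_sub (by simp) (by simp), EReal.coe_neg, add_comm]

/-- A feasible `y` is a.s. its mean `c`, and `⟨μ - E[μ], c⟩` integrates to zero. The identity also
covers an infinite integral of `ψ`. -/
theorem objectiveMV_add_inner (hM : M.ConvexityAssumption ℙ)
    (hψ : LowerSemicontinuous fun p : Decision P L × (P → ℝ) => ψ p.1 p.2)
    (hphi : ∀ y ξ, M.phi y ξ = (ψ y (fun i => M.Xavail i ξ) : EReal) - (B : ℝ))
    {y : Ξ → Decision P L} (hy : y ∈ feasibleMV ℙ) {μ : Ξ → Decision P L} (hμ : MemLp μ 1 ℙ) :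
    expectE ℙ (fun ξ => M.phi (y ξ) ξ + ((inner ℝ (μ ξ - ∫ ξ', μ ξ' ∂ℙ) (y ξ) : ℝ) : EReal))
      = ((∫⁻ ξ, ψ (∫ ξ', y ξ' ∂ℙ) (fun i => M.Xavail i ξ) ∂ℙ : ℝ≥0∞) : EReal) - (B : ℝ) := by
  have hX := measurable_avail hM
  set c := ∫ ξ', y ξ' ∂ℙ with hcdef
  have hn : Integrable (fun ξ => μ ξ - ∫ ξ', μ ξ' ∂ℙ) ℙ :=
    (memLp_one_iff_integrable.1 hμ).sub (integrable_const _)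
  have hae : (fun ξ => M.phi (y ξ) ξ + ((inner ℝ (μ ξ - ∫ ξ', μ ξ' ∂ℙ) (y ξ) : ℝ) : EReal))
      =ᵐ[ℙ] fun ξ => (ψ c (fun i => M.Xavail i ξ) : EReal)
        + ((inner ℝ c (μ ξ - ∫ ξ', μ ξ' ∂ℙ) - B : ℝ) : EReal) := by
    filter_upwards [hy.2] with ξ hξ
    rw [sub_eq_zero.1 hξ, hphi, ← hcdef, real_inner_comm, EReal.coe_sub, sub_eq_add_neg (a := (ψ c _ : EReal)),
      sub_eq_add_neg (b := (B : EReal)), add_assoc, add_comm (-((B : ℝ) : EReal))]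
  have hcongr := le_antisymm (expectE_mono (hae.mono fun ξ h => h.le))
    (expectE_mono (hae.mono fun ξ h => h.ge))
  have hE := expectE_coe_add (aemeasurable_integrand (w := fun _ => c) hψ hX aemeasurable_const)
    (g := fun ξ => inner ℝ c (μ ξ - ∫ ξ', μ ξ' ∂ℙ) - B)
    ((hn.const_inner c).sub (integrable_const B))
  rw [hcongr, hE, integral_sub (hn.const_inner c)
    (integrable_const B), integral_inner hn,
    integral_sub (memLp_one_iff_integrable.1 hμ) (integrable_const _)]
  simp [sub_eq_add_neg]

theorem objectiveMV_of_feasible (hM : M.ConvexityAssumption ℙ)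
    (hψ : LowerSemicontinuous fun p : Decision P L × (P → ℝ) => ψ p.1 p.2)
    (hphi : ∀ y ξ, M.phi y ξ = (ψ y (fun i => M.Xavail i ξ) : EReal) - (B : ℝ))
    {y : Ξ → Decision P L} (hy : y ∈ feasibleMV ℙ) : M.objectiveMV ℙ y
      = ((∫⁻ ξ, ψ (∫ ξ', y ξ' ∂ℙ) (fun i => M.Xavail i ξ) ∂ℙ : ℝ≥0∞) : EReal) - (B : ℝ) := by
  rw [← objectiveMV_add_inner hM hψ hphi hy (μ := 0) MemLp.zero]
  simp [objectiveMV]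

theorem const_mem_feasibleMV (c : Decision P L) : (fun _ => c) ∈ feasibleMV ℙ :=
  ⟨memLp_const c, ae_of_all _ fun _ => by simp⟩

theorem dualObjective_le_valueMV (hM : M.ConvexityAssumption ℙ)
    (hψ : LowerSemicontinuous fun p : Decision P L × (P → ℝ) => ψ p.1 p.2)
    (hphi : ∀ y ξ, M.phi y ξ = (ψ y (fun i => M.Xavail i ξ) : EReal) - (B : ℝ))
    {μ : Ξ → Decision P L} (hμ : MemLp μ 1 ℙ) : M.dualObjective ℙ μ ≤ M.valueMV ℙ := by
  refine le_iInf₂ fun y hy => (iInf₂_le y hy.1).trans (le_of_eq ?_)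
  rw [objectiveMV_add_inner hM hψ hphi hy hμ, objectiveMV_of_feasible hM hψ hphi hy]

theorem exists_le_neg_expectE_stochLagrangian (hM : M.ConvexityAssumption ℙ)
    (hψ : LowerSemicontinuous fun p : Decision P L × (P → ℝ) => ψ p.1 p.2)
    (hconv : ∀ w y₁ y₂, ∀ a b : ℝ, 0 ≤ a → 0 ≤ b → a + b = 1 →
      ψ (a • y₁ + b • y₂) w ≤ ENNReal.ofReal a * ψ y₁ w + ENNReal.ofReal b * ψ y₂ w)
    (hR : ∀ y w, R < ‖y‖ → ψ y w = ⊤)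
    (hphi : ∀ y ξ, M.phi y ξ = (ψ y (fun i => M.Xavail i ξ) : EReal) - (B : ℝ))
    {c : Decision P L} (hc : ∫⁻ ξ, ψ c (fun i => M.Xavail i ξ) ∂ℙ ≠ ⊤)
    (hmin : ∀ y, ∫⁻ ξ, ψ c (fun i => M.Xavail i ξ) ∂ℙ ≤ ∫⁻ ξ, ψ y (fun i => M.Xavail i ξ) ∂ℙ)
    {a : ℝ} (ha : a < (∫⁻ ξ, ψ c (fun i => M.Xavail i ξ) ∂ℙ).toReal) :
    ∃ μ : Ξ → Decision P L, MemLp μ 1 ℙ ∧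
      ((a - B : ℝ) : EReal) ≤ -expectE ℙ (M.stochLagrangian ℙ μ) := by
  have hX := measurable_avail hM
  obtain ⟨n, hn, hn0, hle⟩ : ∃ n : Ξ → Decision P L, MemLp n 1 ℙ ∧ ∫ ξ, n ξ ∂ℙ = 0 ∧
      a ≤ (∫⁻ ξ, ⨅ y, tilt ψ R y (fun i => M.Xavail i ξ, n ξ) ∂ℙ).toReal
        - R * ∫ ξ, ‖n ξ‖ ∂ℙ := by
    -- For `a < 0`, `ENNReal.ofReal a = 0` need not lie strictly below the optimum; the zero
    -- multiplier works because the integrand is nonnegative.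
    rcases lt_or_ge a 0 with ha0 | ha0
    · refine ⟨0, MemLp.zero, by simp, ?_⟩
      simp only [Pi.zero_apply, norm_zero, integral_zero, mul_zero, sub_zero]
      exact ha0.le.trans ENNReal.toReal_nonneg
    · refine exists_multiplier_le_lintegral_iInf_tilt hψ hconv hX hR (fun y => ?_) hc
      exact ((ENNReal.ofReal_lt_iff_lt_toReal ha0 hc).2 ha).trans_le (hmin y)
  refine ⟨-n, hn.neg, ?_⟩
  rw [(expectE_stochLagrangian hM hψ hR hphi hc hn.neg).1, ← EReal.coe_neg, EReal.coe_le_coe_iff]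
  have h0 : ∀ ξ, (∫ ξ', (-n) ξ' ∂ℙ) - (-n) ξ = n ξ := by
    intro ξ
    simp [integral_neg, hn0]
  simp only [h0]
  linarith

end Market

namespace Market

variable {N P Ξ : Type*} [DecidableEq N] [Fintype P] {L : Finset (N × N)} [MeasurableSpace Ξ]
  {ℙ : Measure Ξ} [IsProbabilityMeasure ℙ] {M : Market N P L Ξ}
  {ψ : Decision P L → (P → ℝ) → ℝ≥0∞} {B : ℝ}

theorem valueMV_eq_of_isOptimalMV (hM : M.ConvexityAssumption ℙ)
    (hψ : LowerSemicontinuous fun p : Decision P L × (P → ℝ) => ψ p.1 p.2)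
    (hphi : ∀ y ξ, M.phi y ξ = (ψ y (fun i => M.Xavail i ξ) : EReal) - (B : ℝ))
    {ybar : Ξ → Decision P L} (hopt : M.IsOptimalMV ℙ ybar) (hfin : M.valueMV ℙ < ⊤) :
    ∃ c, ∫⁻ ξ, ψ c (fun i => M.Xavail i ξ) ∂ℙ ≠ ⊤ ∧
      (∀ y, ∫⁻ ξ, ψ c (fun i => M.Xavail i ξ) ∂ℙ ≤ ∫⁻ ξ, ψ y (fun i => M.Xavail i ξ) ∂ℙ) ∧
      M.valueMV ℙ
        = (((∫⁻ ξ, ψ c (fun i => M.Xavail i ξ) ∂ℙ).toReal - B : ℝ) : EReal) := by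
  have hvalue : M.valueMV ℙ = M.objectiveMV ℙ ybar :=
    le_antisymm (iInf₂_le ybar hopt.1) (le_iInf₂ hopt.2)
  rw [objectiveMV_of_feasible hM hψ hphi hopt.1] at hvalue
  have hc : ∫⁻ ξ, ψ (∫ ξ', ybar ξ' ∂ℙ) (fun i => M.Xavail i ξ) ∂ℙ ≠ ⊤ := by
    intro htop
    rw [hvalue, htop] at hfin
    exact absurd hfin (by simp)
  refine ⟨∫ ξ, ybar ξ ∂ℙ, hc, fun y => ?_, ?_⟩
  · have h := hopt.2 _ (const_mem_feasibleMV y)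
    rw [objectiveMV_of_feasible hM hψ hphi hopt.1,
      objectiveMV_of_feasible hM hψ hphi (const_mem_feasibleMV y),
      EReal.sub_le_iff_le_add (by simp) (by simp), sub_eq_add_neg, add_assoc, ← EReal.coe_neg,
      ← EReal.coe_add, neg_add_cancel, EReal.coe_zero, add_zero,
      EReal.coe_ennreal_le_coe_ennreal_iff] at h
    simpa using h
  · rw [hvalue, EReal.coe_sub, EReal.coe_ennreal_toReal hc]

end Market

end

theorem proposition2 {N P Ξ : Type*} [DecidableEq N] [Fintype P] {L : Finset (N × N)}
    [MeasurableSpace Ξ] (ℙ : Measure Ξ) [IsProbabilityMeasure ℙ] (M : Market N P L Ξ)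
    (hM : M.ConvexityAssumption ℙ) (ybar : Ξ → Decision P L) (hopt : M.IsOptimalMV ℙ ybar)
    (hfin : M.valueMV ℙ < ⊤) :
    (∃ μ : Ξ → Decision P L, MemLp μ 1 ℙ ∧ ⊥ < M.dualObjective ℙ μ) ∧
    (⨆ μ ∈ {μ : Ξ → Decision P L | MemLp μ 1 ℙ}, M.dualObjective ℙ μ) = M.valueMV ℙ ∧
    (∃ μ : Ξ → Decision P L, MemLp μ 1 ℙ ∧ expectE ℙ (M.stochLagrangian ℙ μ) < ⊤) ∧
    (⨆ μ ∈ {μ : Ξ → Decision P L | MemLp μ 1 ℙ}, -expectE ℙ (M.stochLagrangian ℙ μ))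
      = M.valueMV ℙ := by
  have hex := Market.exists_integrand hM
  obtain ⟨ψ, B, R, hψ, hconv, hR, hphi⟩ := hex
  have hex := Market.valueMV_eq_of_isOptimalMV hM hψ hphi hopt hfin
  obtain ⟨c, hc, hmin, hvalue⟩ := hex
  have hweak : ∀ μ : Ξ → Decision P L, MemLp μ 1 ℙ → M.dualObjective ℙ μ ≤ M.valueMV ℙ :=
    fun μ hμ => Market.dualObjective_le_valueMV hM hψ hphi hμ
  have hlag : ∀ μ : Ξ → Decision P L, MemLp μ 1 ℙ →
      -expectE ℙ (M.stochLagrangian ℙ μ) ≤ M.dualObjective ℙ (-μ) :=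
    fun μ hμ => Market.neg_expectE_stochLagrangian_le_dualObjective hM hψ hR hphi hc hμ
  have hstrong : M.valueMV ℙ
      ≤ ⨆ μ ∈ {μ : Ξ → Decision P L | MemLp μ 1 ℙ}, -expectE ℙ (M.stochLagrangian ℙ μ) := by
    rw [hvalue]
    -- It suffices to reach every real `r` below the value; the shift by `B` makes `r + B` the level
    -- to separate.
    refine EReal.ge_of_forall_gt_iff_ge.1 fun r hr => ?_
    rw [EReal.coe_lt_coe_iff] at hr
    have hex := Market.exists_le_neg_expectE_stochLagrangian hM hψ hconv hR hphi hc hmin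
      (a := r + B) (by linarith)
    obtain ⟨μ, hμ, hle⟩ := hex
    rw [add_sub_cancel_right] at hle
    exact hle.trans (le_iSup₂ (f := fun (μ : Ξ → Decision P L)
      (_ : μ ∈ {μ : Ξ → Decision P L | MemLp μ 1 ℙ}) => -expectE ℙ (M.stochLagrangian ℙ μ)) μ hμ)
  have h0 : MemLp (0 : Ξ → Decision P L) 1 ℙ := MemLp.zero
  -- The expected Lagrangian is a real number for every `μ ∈ L¹`, so `μ = 0` witnesses both
  -- feasibility claims.
  have hzero := (Market.expectE_stochLagrangian hM hψ hR hphi hc h0).1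
  have hfeas : ⊥ < M.dualObjective ℙ (-0) := by
    refine lt_of_lt_of_le ?_ (hlag 0 h0)
    rw [hzero, ← EReal.coe_neg]
    exact EReal.bot_lt_coe _
  have hdual : (⨆ μ ∈ {μ : Ξ → Decision P L | MemLp μ 1 ℙ}, -expectE ℙ (M.stochLagrangian ℙ μ))
      ≤ ⨆ μ ∈ {μ : Ξ → Decision P L | MemLp μ 1 ℙ}, M.dualObjective ℙ μ :=
    iSup₂_le fun μ hμ => (hlag μ hμ).trans (le_iSup₂ (f := fun (μ : Ξ → Decision P L)
      (_ : μ ∈ {μ : Ξ → Decision P L | MemLp μ 1 ℙ}) => M.dualObjective ℙ μ) (-μ) (MemLp.neg hμ))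
  have hle : (⨆ μ ∈ {μ : Ξ → Decision P L | MemLp μ 1 ℙ}, M.dualObjective ℙ μ) ≤ M.valueMV ℙ :=
    iSup₂_le hweak
  refine ⟨⟨0, h0, by rwa [neg_zero] at hfeas⟩, le_antisymm hle (hstrong.trans hdual),
    ⟨0, h0, ?_⟩, le_antisymm (hdual.trans hle) hstrong⟩
  rw [hzero]
  exact EReal.coe_lt_top _
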